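/- There is an absolute constant $C>0$ such that the following holds for all integers $n\ge 2$ and $m\ge 0$, all multipliers $\alpha_1,\dots,\alpha_m\ge 0$, and every probability distribution $\mathcal D$ on $[0,\infty)$ that has a density $f$ and a monotone hazard rate, i.e. with $F$ the cumulative distribution function, $x\mapsto f(x)/(1-F(x))$ is non-decreasing on $\{x: F(x)<1\}$ (for some version of the density). Let $n$ buyers have i.i.d. types $t_1,\dots,t_n\sim\mathcal D$, and let $v_{i,j}=\alpha_j t_i$ be the value of buyer $i$ for item $j\in\{1,\dots,m\}$; each buyer wants at most one item. The buyers arrive in the order $1,\dots,n$. When buyer $i$ arrives, let $M^{(i)}$ be the set of unsold items, listed as $\ell_1,\ell_2,\dots$ by non-increasing multiplier (equal multipliers by index), and put $a_k=\alpha_{\ell_k}$ for $k\le|M^{(i)}|$ and $a_k=0$ for $k>|M^{(i)}|$. Item $\ell_{r}$ is offered at the price $$p^{(i)}_{\ell_r}=\sum_{k=r}^{n-i}(a_k-a_{k+1})\,F^{-1}\Bigl(1-\frac{k}{n-i+1}\Bigr),\qquad F^{-1}(q)=\inf\{x: F(x)\ge q\}$$ (an empty sum is $0$). Buyer $i$ buys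 an unsold item $j$ maximizing her utility $v_{i,j}-p^{(i)}_j$ if the maximal utility is positive, and nothing if all utilities are negative; ties between items, and between buying and not buying when the maximal utility is $0$, are broken arbitrarily. Let $\mathrm{SW}_{\mathrm{pp}}$ be the sum of the values of the buyers for the items they bought, and let $\mathrm{SW}_{\mathrm{opt}}$ be the maximum of $\sum_i v_{i,j_i}$ over all matchings of buyers to items (unmatched buyers contribute $0$). Then both welfares are integrable and, however ties are broken, $$\mathbb E[\mathrm{SW}_{\mathrm{pp}}]\;\ge\;\Bigl(1-\frac{C}{\log n}\Bigr)\,\mathbb E[\mathrm{SW}_{\mathrm{opt}}],$$ i.e. the mechanism is $1-O(1/\log n)$-competitive for social welfare. Moreover, if $m=n$, ties can be broken (measurably) so that almost surely every buyer buys an item and, for every $i$, every set $M$ of items and every $j\in M$, $$\Pr\bigl[M^{(i)}=M,\ \text{buyer } i \text{ buys } j\bigr]=\frac{1}{n-i+1}\Pr\bigl[M^{(i)}=M\bigr],$$ i.e. each step sells one item and each remaining item is equally likely to be sold. -/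

import Mathlib

open MeasureTheory ProbabilityTheory

/-! ## Posted-prices mechanisms for unit-demand buyers

There are `n` buyers, arriving in the order `0, 1, …, n - 1`, and `m` items. -/

/-- An allocation gives each buyer an item, or nothing (`none`). -/
abbrev Allocation (n m : ℕ) : Type := Fin n → Option (Fin m)

/-- The items that have not been sold before buyer `i` arrives. -/
def remaining {n m : ℕ} (A : Allocation n m) (i : Fin n) : Finset (Fin m) :=
  Finset.univ.filter fun j => ∀ i' < i, A i' ≠ some j

/-- Dynamic prices: the price of an item `j` that is offered to buyer `i` when `M` is the set of
remaining items. -/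
abbrev PricingRule (n m : ℕ) : Type := Fin n → Finset (Fin m) → Fin m → ℝ

/-- `A` is a possible outcome of the posted-prices mechanism with prices `p`, when the value of
buyer `i` for item `j` is `v i j`: every buyer in turn buys a remaining item that maximizes her
utility, provided that this utility is not negative. Ties between items, and between buying at
utility zero and not buying, may be broken in any way. -/
def IsOutcome {n m : ℕ} (p : PricingRule n m) (v : Fin n → Fin m → ℝ) (A : Allocation n m) :
    Prop :=
  ∀ i : Fin n,
    (∀ j, A i = some j →
      j ∈ remaining A i ∧ 0 ≤ v i j - p i (remaining A i) j ∧
        ∀ j' ∈ remaining A i,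
          v i j' - p i (remaining A i) j' ≤ v i j - p i (remaining A i) j) ∧
    (A i = none → ∀ j ∈ remaining A i, v i j - p i (remaining A i) j ≤ 0)

/-- No item is given to two buyers. -/
def IsMatching {n m : ℕ} (A : Allocation n m) : Prop :=
  ∀ i i' j, A i = some j → A i' = some j → i = i'

/-- The social welfare of an allocation. -/
def welfare {n m : ℕ} (v : Fin n → Fin m → ℝ) (A : Allocation n m) : ℝ :=
  ∑ i, (A i).elim 0 (v i)

/-- The optimal (offline) social welfare: the maximum weight of a matching. -/
noncomputable def optWelfare {n m : ℕ} (v : Fin n → Fin m → ℝ) : ℝ :=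
  ⨆ A : {A : Allocation n m // IsMatching A}, welfare v A.1

/-- Separable valuations: a buyer of type `t i` has value `α j * t i` for item `j`. -/
def separable {n m : ℕ} (α : Fin m → ℝ) (t : Fin n → ℝ) : Fin n → Fin m → ℝ :=
  fun i j => α j * t i

/-! ## Distributions -/

/-- `D` has a probability density `f` for which the hazard rate `f x / (1 - F x)`, where `F` is the
cumulative distribution function, is non-decreasing on the set of all `x` with `F x < 1`. -/
def HasMonotoneHazardRate (D : Measure ℝ) : Prop :=
  ∃ f : ℝ → ℝ, Measurable f ∧ (∀ x, 0 ≤ f x) ∧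
    D = volume.withDensity (fun x => ENNReal.ofReal (f x)) ∧
    MonotoneOn (fun x => f x / (1 - cdf D x)) {x | cdf D x < 1}

/-- The quantile function `F⁻¹` (used for `0 < q < 1` only). -/
noncomputable def quantile (D : Measure ℝ) (q : ℝ) : ℝ :=
  sInf {x | q ≤ cdf D x}

/-! ## The quantile-based dynamic prices -/

/-- The `k`-th largest multiplier (`k = 1, 2, …`) of an item in `M`, counted with multiplicity, and
`0` for `k > |M|`. -/
noncomputable def kthMultiplier {m : ℕ} (α : Fin m → ℝ) (M : Finset (Fin m)) (k : ℕ) : ℝ :=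
  ((M.val.map α).sort (· ≥ ·)).getD (k - 1) 0

/-- The position `1, 2, …` of the item `j ∈ M` in `M`, when items are sorted by decreasing
multiplier and items with equal multipliers by their index. -/
noncomputable def position {m : ℕ} (α : Fin m → ℝ) (M : Finset (Fin m)) (j : Fin m) : ℕ :=
  (M.filter fun j' => α j < α j' ∨ (α j' = α j ∧ j' ≤ j)).card

/-- When buyer `i` arrives, `n - i` buyers (including her) remain. With `a k` the `k`-th largest
multiplier of a remaining item, the remaining item in position `k₀` has the price
`∑ (a k - a (k+1)) F⁻¹(1 - k / (n - i))`, summed over `k₀ ≤ k < n - i`. -/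
noncomputable def quantilePrices (n : ℕ) {m : ℕ} (D : Measure ℝ) (α : Fin m → ℝ) :
    PricingRule n m :=
  fun i M j => ∑ k ∈ Finset.Ico (position α M j) (n - (i : ℕ)),
    (kthMultiplier α M k - kthMultiplier α M (k + 1)) *
      quantile D (1 - (k : ℝ) / ((n : ℝ) - (i : ℕ)))

/-- Every pricing rule has an outcome for every valuation profile. -/
theorem exists_isOutcome {n m : ℕ} (p : PricingRule n m) (v : Fin n → Fin m → ℝ) :
    ∃ A, IsOutcome p v A := by
  have rem_congr : ∀ (A B : Allocation n m) (i : Fin n), (∀ i' < i, A i' = B i') →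
      remaining A i = remaining B i := by
    intro A B i h
    unfold remaining
    ext j
    simp only [Finset.mem_filter, Finset.mem_univ, true_and]
    exact forall₂_congr fun i' hi' => by rw [h i' hi']
  have choice : ∀ (M : Finset (Fin m)) (u : Fin m → ℝ), ∃ o : Option (Fin m),
      (∀ j, o = some j → j ∈ M ∧ 0 ≤ u j ∧ ∀ j' ∈ M, u j' ≤ u j) ∧
      (o = none → ∀ j ∈ M, u j ≤ 0) := by
    intro M u
    by_cases h : ∀ j ∈ M, u j ≤ 0
    · exact ⟨none, by simp, fun _ => h⟩
    · push Not at h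
      obtain ⟨j₀, hj₀, hu⟩ := h
      obtain ⟨j, hj, hmax⟩ := M.exists_max_image u ⟨j₀, hj₀⟩
      refine ⟨some j, ?_, by simp⟩
      rintro _ ⟨⟩
      exact ⟨hj, hu.le.trans (hmax _ hj₀), hmax⟩
  choose c hc₁ hc₂ using choice
  have key : ∀ k : ℕ, ∃ A : Allocation n m, ∀ i : Fin n, (i : ℕ) < k →
      A i = c (remaining A i) (fun j => v i j - p i (remaining A i) j) := by
    intro k
    induction k with
    | zero => exact ⟨fun _ => none, by simp⟩
    | succ k ih =>
      obtain ⟨A, hA⟩ := ih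
      by_cases hk : k < n
      · set i₀ : Fin n := ⟨k, hk⟩ with hi₀
        set B := Function.update A i₀
          (c (remaining A i₀) (fun j => v i₀ j - p i₀ (remaining A i₀) j)) with hB
        have hR : ∀ i : Fin n, i ≤ i₀ → remaining B i = remaining A i := fun i hi =>
          rem_congr _ _ _ fun i' hi' => Function.update_of_ne (hi'.trans_le hi).ne _ _
        refine ⟨B, fun i hi => ?_⟩
        have hle : i ≤ i₀ := Fin.le_def.2 (Nat.lt_succ_iff.1 hi)
        rw [hR i hle]
        rcases hle.eq_or_lt with rfl | hlt
        · simp [hB]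
        · rw [hB, Function.update_of_ne hlt.ne, ← hA i (Fin.lt_def.1 hlt)]
      · exact ⟨A, fun i _ => hA i (i.2.trans_le (not_lt.1 hk))⟩
  obtain ⟨A, hA⟩ := key n
  exact ⟨A, fun i => ⟨fun j hj => hc₁ _ _ j ((hA i i.2).symm.trans hj),
    fun h => hc₂ _ _ ((hA i i.2).symm.trans h)⟩⟩

/-!
# Quantile-based dynamic prices are `1 - O(1 / log n)`-competitive

Suppose that `N` buyers remain, and let `threshold D x` be the point that a type exceeds with
probability `x`. The quantile prices are such that the utilities of the items in positions `r` and
`r + 1` differ by a nonnegative multiple of `t - threshold D (r / N)` (`utilityAt_sub`). Hence,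
almost surely, a buyer of type `t` obtains the multiplier in the position `demand D N t`, the first
`r` with `r = N` or `threshold D (r / N) < t`, however ties are broken
(`IsOutcome.elim_eq_kthMultiplier`). This position is uniform on `1, …, N` and independent of the
past, which gives the second part of the theorem (`measureReal_demandAllocation_eq`).

For the competitive ratio, the multipliers are decomposed into level sets (`exists_welfare_eq`), so
that it suffices to sell the `k` items whose multiplier is at least `θ`, all of value `1`, and
`k ≤ n` may be assumed. Let `gain D x = E[t; t > threshold x]`. The optimum for these `k` items is at
most `n * gain D (k / n)` (`IsMatching.sum_le`, `integral_add_sum_max`). The mechanism sells one of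
them to the next buyer with conditional probability `X = K / N`, where `K` of them are unsold, and
thereby gains `gain D X` in expectation. Here `K` is hypergeometric, `X` is a martingale with mean
`x = k / n`, and the variance of `X / x` is at most `1 / (x * N)` (`integral_unsold`,
`integral_unsold_mul_pred`).

It remains to bound the loss from the fluctuations of `X`. The function `gain D` is concave and
increasing. A monotone hazard rate means that the cumulative hazard `-log (1 - F)` is convex, and
therefore the conditional mean `gain D x / x`, divided by `-log x`, increases with `x`
(`upperMean_mul_log_le`). Together, with `T = gain D x / x`,
`gain D X ≥ T * X * (1 - 2 / (1 - log x) * log⁺ (X / x))`, and `log y ≤ (y - 1) / √y` for `y ≥ 1`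
turns this into a quadratic lower bound in `X` (`gain_ge_quadratic`). In expectation, the relative
loss in a step is at most `2 / (1 - log x)` times the standard deviation `1 / √(x * N)`. Averaged
over `N = 1, …, n` this is at most `4 / ((1 - log (k / n)) * √k)`, and `log k ≤ 2 * √k - 2` bounds it
by `8 / log n`.
-/

/-! ### Log-concavity of the survival function -/

/-- The survival function `P(t > x)` of a distribution. -/
noncomputable def survival (D : Measure ℝ) (x : ℝ) : ℝ := 1 - cdf D x

section Survival

variable {D : Measure ℝ}

lemma survival_nonneg (x : ℝ) : 0 ≤ survival D x := sub_nonneg.2 (cdf_le_one D x)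

lemma survival_le_one (x : ℝ) : survival D x ≤ 1 := by
  have := cdf_nonneg D x
  unfold survival; linarith

lemma survival_antitone : Antitone (survival D) := fun _ _ h =>
  sub_le_sub_left (monotone_cdf D h) 1

lemma HasMonotoneHazardRate.nullSingletonClass (hD : HasMonotoneHazardRate D) :
    NullSingletonClass D := by
  obtain ⟨f, -, -, hD, -⟩ := hD
  rw [hD]
  infer_instance

variable [IsProbabilityMeasure D]

lemma survival_eq_real (x : ℝ) : survival D x = D.real (Set.Ioi x) := by
  rw [survival, cdf_eq_real, ← Set.compl_Iic, probReal_compl_eq_one_sub measurableSet_Iic]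

lemma ofReal_survival (x : ℝ) : ENNReal.ofReal (survival D x) = D (Set.Ioi x) := by
  rw [survival_eq_real, ofReal_measureReal]

lemma HasMonotoneHazardRate.continuous_survival (hD : HasMonotoneHazardRate D) :
    Continuous (survival D) := by
  have := hD.nullSingletonClass
  refine continuous_const.sub (continuous_iff_continuousAt.2 fun x => ?_)
  rw [(monotone_cdf D).continuousAt_iff_leftLim_eq_rightLim, StieltjesFunction.rightLim_eq]
  have h := (cdf D).measure_singleton x
  rw [measure_cdf, measure_singleton] at h
  exact le_antisymm ((monotone_cdf D).leftLim_le le_rfl)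
    (sub_nonpos.1 (ENNReal.ofReal_eq_zero.1 h.symm))

lemma survival_of_nonpos (hD : HasMonotoneHazardRate D) (h0 : D (Set.Iio 0) = 0) {x : ℝ}
    (hx : x ≤ 0) : survival D x = 1 := by
  have := hD.nullSingletonClass
  have h : D (Set.Iic 0) = 0 := by rw [← Iio_ae_eq_Iic.measure_eq, h0]
  rw [survival, cdf_eq_real, Measure.real, measure_mono_null (Set.Iic_subset_Iic.2 hx) h]
  simp

/-- The cumulative hazard `-log (1 - F)` is the integral of the hazard rate. The hazard rate is
monotone, so it has only countably many discontinuities, and elsewhere the density is continuous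
and is the derivative of `F`. -/
lemma HasMonotoneHazardRate.exists_hazard (hD : HasMonotoneHazardRate D) :
    ∃ h : ℝ → ℝ, MonotoneOn h {x | 0 < survival D x} ∧
      ∀ a b, 0 < survival D (max a b) → IntervalIntegrable h volume a b ∧
        ∫ x in a..b, h x = -Real.log (survival D b) + Real.log (survival D a) := by
  have hcont := hD.continuous_survival
  obtain ⟨f, hfm, hf0, hDf, hmono⟩ := hD
  set S : Set ℝ := {x | 0 < survival D x} with hS
  have hS' : {x | cdf D x < 1} = S := by ext x; simp [hS, survival]
  rw [hS'] at hmono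
  have hSo : IsOpen S := isOpen_lt continuous_const hcont
  set h : ℝ → ℝ := fun x => f x / survival D x with hh
  have hmono : MonotoneOn h S := hmono
  have hfint : Integrable f := by
    refine ⟨hfm.aestronglyMeasurable, ?_⟩
    rw [hasFiniteIntegral_iff_ofReal (Filter.Eventually.of_forall hf0)]
    have := measure_univ (μ := D)
    rw [hDf, withDensity_apply _ MeasurableSet.univ, Measure.restrict_univ] at this
    rw [this]; exact ENNReal.one_lt_top
  have hcdf : ∀ a x, survival D x = survival D a - ∫ y in a..x, f y := by
    have key : ∀ x, cdf D x = ∫ y in Set.Iic x, f y := by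
      intro x
      rw [cdf_eq_real, Measure.real, hDf, withDensity_apply _ measurableSet_Iic,
        integral_eq_lintegral_of_nonneg_ae (Filter.Eventually.of_forall hf0)
          hfm.aestronglyMeasurable]
    intro a x
    rw [← intervalIntegral.integral_Iic_sub_Iic hfint.integrableOn hfint.integrableOn,
      ← key, ← key]
    unfold survival; ring
  refine ⟨h, hmono, fun a b hab => ?_⟩
  have hsub : Set.uIcc a b ⊆ S := by
    rintro x ⟨-, hx⟩
    exact hab.trans_le (survival_antitone hx)
  have hint : IntervalIntegrable h volume a b := (hmono.mono hsub).intervalIntegrable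
  refine ⟨hint, ?_⟩
  rw [integral_eq_of_hasDerivAt_off_countable (fun x => -Real.log (survival D x)) h
    hmono.countable_not_continuousWithinAt (s := {x ∈ S | ¬ContinuousWithinAt h S x}) ?_ ?_ hint]
  · ring
  · exact (hcont.continuousOn.log fun x hx => (hsub hx).ne').neg
  · rintro x ⟨hx, hxs⟩
    have hxS : x ∈ S := hsub (Set.Ioo_subset_Icc_self hx)
    have hhc : ContinuousAt h x := by
      by_contra hc
      exact hxs ⟨hxS, fun hc' => hc (hc'.continuousAt (hSo.mem_nhds hxS))⟩
    have hfc : ContinuousAt f x := by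
      refine (hhc.mul hcont.continuousAt).congr ?_
      filter_upwards [hSo.mem_nhds hxS] with y hy
      exact div_mul_cancel₀ _ (ne_of_gt hy)
    have hd : HasDerivAt (survival D) (-f x) x := by
      have h1 := intervalIntegral.integral_hasDerivAt_right (a := x) (b := x)
        hfint.intervalIntegrable (hfm.stronglyMeasurable.stronglyMeasurableAtFilter) hfc
      rw [show survival D = fun z => survival D x - ∫ y in x..z, f y from funext (hcdf x)]
      exact h1.const_sub _
    have := (hd.log (ne_of_gt hxS)).neg
    rwa [neg_div, neg_neg] at this

/-- A residual lifetime is stochastically decreasing in the age. -/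
lemma survival_add_mul_le (hD : HasMonotoneHazardRate D) {a b z : ℝ} (hab : a ≤ b) (hz : 0 ≤ z) :
    survival D (b + z) * survival D a ≤ survival D (a + z) * survival D b := by
  rcases (survival_nonneg (D := D) (b + z)).eq_or_lt with h0 | hpos
  · rw [← h0, zero_mul]
    exact mul_nonneg (survival_nonneg _) (survival_nonneg _)
  have hb : 0 < survival D b := hpos.trans_le (survival_antitone (by linarith))
  have ha : 0 < survival D a := hb.trans_le (survival_antitone hab)
  have haz : 0 < survival D (a + z) := hpos.trans_le (survival_antitone (by linarith))
  obtain ⟨h, hm, hi⟩ := hD.exists_hazard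
  obtain ⟨i1, e1⟩ := hi a (a + z) (by rwa [max_eq_right (by linarith)])
  obtain ⟨i2, e2⟩ := hi b (b + z) (by rwa [max_eq_right (by linarith)])
  have hle : ∫ x in a..(a + z), h x ≤ ∫ x in b..(b + z), h x := by
    have e3 : ∫ x in a..(a + z), h (x + (b - a)) = ∫ x in b..(b + z), h x := by
      rw [intervalIntegral.integral_comp_add_right]
      congr 1 <;> ring
    have i3 : IntervalIntegrable (fun x => h (x + (b - a))) volume a (a + z) := by
      have := i2.comp_add_right (b - a)
      convert this using 1 <;> ring
    rw [← e3]
    refine intervalIntegral.integral_mono_on (by linarith) i1 i3 fun x hx => ?_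
    refine hm (haz.trans_le (survival_antitone hx.2))
      (hpos.trans_le (survival_antitone ?_)) (by linarith)
    linarith [hx.2]
  rw [e1, e2] at hle
  rw [← Real.log_le_log_iff (by positivity) (by positivity), Real.log_mul hpos.ne' ha.ne',
    Real.log_mul haz.ne' hb.ne']
  linarith

/-- The cumulative hazard is star-shaped: being convex and `0` at `0`, it lies below its chords
from the origin. -/
lemma mul_neg_log_survival_le (hD : HasMonotoneHazardRate D) (h0 : D (Set.Iio 0) = 0) {a b : ℝ}
    (ha : 0 ≤ a) (hab : a ≤ b) (hb : 0 < survival D b) :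
    b * -Real.log (survival D a) ≤ a * -Real.log (survival D b) := by
  obtain ⟨h, hm, hi⟩ := hD.exists_hazard
  have hb0 := ha.trans hab
  have hS0 : Real.log (survival D 0) = 0 := by
    rw [survival_of_nonpos hD h0 le_rfl, Real.log_one]
  obtain ⟨i1, e1⟩ := hi 0 a (by rw [max_eq_right ha]; exact hb.trans_le (survival_antitone hab))
  obtain ⟨i2, e2⟩ := hi 0 b (by rwa [max_eq_right hb0])
  rw [hS0, add_zero] at e1 e2
  rw [← e1, ← e2]
  have s1 := intervalIntegral.mul_integral_comp_mul_left (a := 0) (b := 1) (f := h) a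
  have s2 := intervalIntegral.mul_integral_comp_mul_left (a := 0) (b := 1) (f := h) b
  simp only [mul_zero, mul_one] at s1 s2
  have hmem : ∀ c ≤ b, c ∈ {x | 0 < survival D x} := fun c hc => hb.trans_le (survival_antitone hc)
  have hmon : ∀ c, 0 ≤ c → c ≤ b → IntervalIntegrable (fun x => h (c * x)) volume 0 1 := by
    intro c hc hcb
    refine MonotoneOn.intervalIntegrable ?_
    rw [Set.uIcc_of_le zero_le_one]
    intro x hx y hy hxy
    exact hm (hmem _ ((mul_le_of_le_one_right hc hx.2).trans hcb))
      (hmem _ ((mul_le_of_le_one_right hc hy.2).trans hcb)) (mul_le_mul_of_nonneg_left hxy hc)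
  have hle : ∫ x in (0:ℝ)..1, h (a * x) ≤ ∫ x in (0:ℝ)..1, h (b * x) := by
    refine intervalIntegral.integral_mono_on zero_le_one (hmon a ha hab) (hmon b hb0 le_rfl)
      fun x hx => ?_
    exact hm (hmem _ ((mul_le_of_le_one_right ha hx.2).trans hab))
      (hmem _ (mul_le_of_le_one_right hb0 hx.2)) (mul_le_mul_of_nonneg_right hab hx.1)
  rw [← s1, ← s2]
  calc b * (a * ∫ x in (0:ℝ)..1, h (a * x)) = a * b * ∫ x in (0:ℝ)..1, h (a * x) := by ring
    _ ≤ a * b * ∫ x in (0:ℝ)..1, h (b * x) := by gcongr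
    _ = _ := by ring

/-- A distribution with a monotone hazard rate has a finite mean: its survival function decays
geometrically. -/
lemma HasMonotoneHazardRate.integrable_id (hD : HasMonotoneHazardRate D)
    (h0 : D (Set.Iio 0) = 0) : Integrable (fun x => x) D := by
  obtain ⟨y, hy0, hy⟩ : ∃ y : ℝ, 0 < y ∧ survival D y < 1 := by
    obtain ⟨y, hy, hy1⟩ := (((tendsto_cdf_atTop D).eventually (lt_mem_nhds zero_lt_one)).and
      (Filter.eventually_gt_atTop 0)).exists
    exact ⟨y, hy1, by unfold survival; linarith⟩
  have hgeo : ∀ k : ℕ, survival D (k * y) ≤ survival D y ^ k := by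
    intro k
    induction k with
    | zero => simpa using survival_le_one _
    | succ k ih =>
      have h := survival_add_mul_le hD (a := 0) (b := k * y) (z := y) (by positivity) hy0.le
      rw [survival_of_nonpos hD h0 le_rfl, mul_one, zero_add] at h
      calc survival D ((k + 1 : ℕ) * y) = survival D (k * y + y) := by push_cast; ring_nf
        _ ≤ survival D y * survival D (k * y) := h
        _ ≤ survival D y * survival D y ^ k := by gcongr; exact survival_nonneg _
        _ = _ := by ring
  have hnn : ∀ᵐ x ∂D, 0 ≤ x := by
    rw [ae_iff]; simpa [Set.Iio] using h0
  refine ⟨measurable_id.aestronglyMeasurable, ?_⟩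
  rw [hasFiniteIntegral_iff_ofReal hnn]
  have hpt : ∀ x : ℝ, ENNReal.ofReal x ≤
      ∑' k : ℕ, (Set.Ioi (k * y)).indicator (fun _ => ENNReal.ofReal y) x := by
    intro x
    refine le_trans ?_ (ENNReal.sum_le_tsum (Finset.range ⌈x / y⌉₊))
    have : ∀ k ∈ Finset.range ⌈x / y⌉₊,
        (Set.Ioi (k * y)).indicator (fun _ => ENNReal.ofReal y) x = ENNReal.ofReal y := by
      intro k hk
      refine Set.indicator_of_mem ?_ _
      have := Nat.lt_ceil.1 (Finset.mem_range.1 hk)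
      exact (lt_div_iff₀ hy0).1 this
    rw [Finset.sum_congr rfl this, Finset.sum_const, Finset.card_range, nsmul_eq_mul,
      ← ENNReal.ofReal_natCast, ← ENNReal.ofReal_mul (by positivity)]
    exact ENNReal.ofReal_le_ofReal ((div_le_iff₀ hy0).1 (Nat.le_ceil _))
  calc ∫⁻ x, ENNReal.ofReal x ∂D
      ≤ ∫⁻ x, ∑' k : ℕ, (Set.Ioi (k * y)).indicator (fun _ => ENNReal.ofReal y) x ∂D :=
        lintegral_mono hpt
    _ = ∑' k : ℕ, ENNReal.ofReal y * ENNReal.ofReal (survival D (k * y)) := by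
        rw [lintegral_tsum fun k => (measurable_const.indicator measurableSet_Ioi).aemeasurable]
        refine tsum_congr fun k => ?_
        rw [lintegral_indicator_const measurableSet_Ioi, ofReal_survival]
    _ ≤ ∑' k : ℕ, ENNReal.ofReal y * ENNReal.ofReal (survival D y) ^ k := by
        refine ENNReal.tsum_le_tsum fun k => ?_
        rw [← ENNReal.ofReal_pow (survival_nonneg _)]
        gcongr
        exact hgeo k
    _ = ENNReal.ofReal y * (1 - ENNReal.ofReal (survival D y))⁻¹ := by
        rw [ENNReal.tsum_mul_left, ENNReal.tsum_geometric]
    _ < ⊤ := by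
        refine ENNReal.mul_lt_top ENNReal.ofReal_lt_top (ENNReal.inv_lt_top.2 ?_)
        rw [tsub_pos_iff_lt, ← ENNReal.ofReal_one]
        exact (ENNReal.ofReal_lt_ofReal_iff zero_lt_one).2 hy

end Survival

/-! ### Conditional means above a threshold -/

/-- The partial expectation `E[t; t > y]`. -/
noncomputable def upperMean (D : Measure ℝ) (y : ℝ) : ℝ := ∫ x in Set.Ioi y, x ∂D

section UpperMean

variable {D : Measure ℝ}

lemma upperMean_anti (hI : Integrable (fun x => x) D) {a b : ℝ} (ha : 0 ≤ a) (hab : a ≤ b) :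
    upperMean D b ≤ upperMean D a :=
  setIntegral_mono_set hI.integrableOn
    ((ae_restrict_iff' measurableSet_Ioi).2 (Filter.Eventually.of_forall fun _ hx =>
      ha.trans (le_of_lt hx))) (Set.Ioi_subset_Ioi hab).eventuallyLE

lemma upperMean_nonneg {a : ℝ} (ha : 0 ≤ a) : 0 ≤ upperMean D a :=
  setIntegral_nonneg measurableSet_Ioi fun _ hx => ha.trans (le_of_lt hx)

variable [IsProbabilityMeasure D]

lemma setIntegral_sub_eq (hI : Integrable (fun x => x) D) (y : ℝ) :
    ∫ x in Set.Ioi y, (x - y) ∂D = upperMean D y - y * survival D y := by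
  rw [integral_sub hI.integrableOn (integrable_const y).integrableOn, setIntegral_const,
    survival_eq_real, smul_eq_mul, mul_comm y, upperMean]

lemma integral_max_sub (hI : Integrable (fun x => x) D) (y : ℝ) :
    ∫ x, max (x - y) 0 ∂D = upperMean D y - y * survival D y := by
  rw [← setIntegral_sub_eq hI, ← integral_indicator measurableSet_Ioi]
  refine integral_congr_ae (Filter.Eventually.of_forall fun x => ?_)
  by_cases hx : y < x
  · simp [hx, hx.le]
  · simp [hx, not_lt.1 hx]

lemma lintegral_survival_add (hI : Integrable (fun x => x) D) (y : ℝ) :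
    ENNReal.ofReal (upperMean D y - y * survival D y) =
      ∫⁻ z in Set.Ioi 0, ENNReal.ofReal (survival D (y + z)) := by
  have hIy : Integrable (fun x => x - y) D := hI.sub (integrable_const y)
  rw [← integral_max_sub hI, ofReal_integral_eq_lintegral_ofReal (f := fun x => max (x - y) 0)
    hIy.pos_part (Filter.Eventually.of_forall fun x => le_max_right _ _),
    lintegral_eq_lintegral_meas_lt (f := fun x => max (x - y) 0) _
      (Filter.Eventually.of_forall fun x => le_max_right _ _) hIy.pos_part.aemeasurable]
  refine setLIntegral_congr_fun measurableSet_Ioi fun z hz => ?_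
  rw [ofReal_survival]
  congr 1
  ext x
  have hz : 0 < z := hz
  simp only [lt_sup_iff, Set.mem_ofPred_eq, Set.mem_Ioi, hz.not_gt, or_false]
  exact lt_sub_iff_add_lt'

lemma mul_survival_le_upperMean (hI : Integrable (fun x => x) D) (y : ℝ) :
    y * survival D y ≤ upperMean D y := by
  rw [← sub_nonneg, ← setIntegral_sub_eq hI]
  exact setIntegral_nonneg measurableSet_Ioi fun x hx => sub_nonneg.2 (le_of_lt hx)

/-- The mean residual life is decreasing in the age. -/
lemma mean_residual_life_le (hD : HasMonotoneHazardRate D) (hI : Integrable (fun x => x) D)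
    {a b : ℝ} (hab : a ≤ b) :
    (upperMean D b - b * survival D b) * survival D a ≤
      (upperMean D a - a * survival D a) * survival D b := by
  rw [← ENNReal.ofReal_le_ofReal_iff (mul_nonneg (sub_nonneg.2 (mul_survival_le_upperMean hI a))
    (survival_nonneg b)), ENNReal.ofReal_mul' (survival_nonneg a),
    ENNReal.ofReal_mul' (survival_nonneg b), lintegral_survival_add hI, lintegral_survival_add hI,
    ← lintegral_mul_const' _ _ ENNReal.ofReal_ne_top,
    ← lintegral_mul_const' _ _ ENNReal.ofReal_ne_top]
  refine setLIntegral_mono' measurableSet_Ioi fun z hz => ?_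
  rw [← ENNReal.ofReal_mul' (survival_nonneg a), ← ENNReal.ofReal_mul' (survival_nonneg b)]
  exact ENNReal.ofReal_le_ofReal (survival_add_mul_le hD hab (le_of_lt hz))

/-- The conditional mean `E[t | t > y]`, divided by the cumulative hazard at `y`, is decreasing
in `y`: this holds both for `y` and for the mean residual life, whose sum is `E[t | t > y]`. -/
lemma upperMean_mul_log_le (hD : HasMonotoneHazardRate D) (h0 : D (Set.Iio 0) = 0) {a b : ℝ}
    (ha : 0 ≤ a) (hab : a ≤ b) (hb : 0 < survival D b) :
    upperMean D b * survival D a * -Real.log (survival D a) ≤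
      upperMean D a * survival D b * -Real.log (survival D b) := by
  have hI := hD.integrable_id h0
  have h1 := mean_residual_life_le hD hI hab
  have h2 := mul_neg_log_survival_le hD h0 ha hab hb
  have hsa : 0 < survival D a := hb.trans_le (survival_antitone hab)
  have hla : 0 ≤ -Real.log (survival D a) :=
    neg_nonneg.2 (Real.log_nonpos hsa.le (survival_le_one a))
  have hlab : -Real.log (survival D a) ≤ -Real.log (survival D b) :=
    neg_le_neg (Real.log_le_log hb (survival_antitone hab))
  have hR := sub_nonneg.2 (mul_survival_le_upperMean hI a)
  set la := -Real.log (survival D a)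
  set lb := -Real.log (survival D b)
  calc upperMean D b * survival D a * la
      = (upperMean D b - b * survival D b) * survival D a * la
        + survival D a * survival D b * (b * la) := by ring
    _ ≤ (upperMean D a - a * survival D a) * survival D b * lb
        + survival D a * survival D b * (a * lb) := by gcongr
    _ = _ := by ring

/-- Partial expectations are concave in the tail probability. -/
lemma upperMean_mul_survival_le (hI : Integrable (fun x => x) D) {a b : ℝ} (hab : a ≤ b) :
    upperMean D a * survival D b ≤ upperMean D b * survival D a := by
  have hsplit : upperMean D a = ∫ x in Set.Ioc a b, x ∂D + upperMean D b := by
    rw [upperMean, ← Set.Ioc_union_Ioi_eq_Ioi hab, setIntegral_union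
      (Set.Ioc_disjoint_Ioi le_rfl) measurableSet_Ioi hI.integrableOn hI.integrableOn, upperMean]
  have hle : ∫ x in Set.Ioc a b, x ∂D ≤ b * (survival D a - survival D b) := by
    have h1 : ∫ x in Set.Ioc a b, x ∂D ≤ ∫ x in Set.Ioc a b, b ∂D :=
      setIntegral_mono_on hI.integrableOn (integrable_const b).integrableOn measurableSet_Ioc
        fun x hx => hx.2
    rwa [setIntegral_const, smul_eq_mul, mul_comm, show D.real (Set.Ioc a b) =
      survival D a - survival D b by
        rw [survival_eq_real, survival_eq_real, ← Set.Ioi_sdiff_Ioi,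
          measureReal_sdiff (Set.Ioi_subset_Ioi hab) measurableSet_Ioi]] at h1
  have hb := mul_survival_le_upperMean hI b
  have hs := survival_antitone (D := D) hab
  rw [hsplit]
  have hsb := survival_nonneg (D := D) b
  nlinarith [mul_le_mul_of_nonneg_right hle hsb,
    mul_le_mul_of_nonneg_right hb (sub_nonneg.2 hs)]

end UpperMean

/-! ### Selling with a given probability -/

/-- The threshold that a type exceeds with probability `x`; it is `0` for `x ≥ 1`,
as types are almost surely positive. -/
noncomputable def threshold (D : Measure ℝ) (x : ℝ) : ℝ := if x < 1 then quantile D (1 - x) else 0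

/-- The contribution `E[t; t > threshold x]` to the welfare of a sale with probability `x`. -/
noncomputable def gain (D : Measure ℝ) (x : ℝ) : ℝ :=
  if 0 < x then upperMean D (threshold D x) else 0

section Threshold

variable {D : Measure ℝ}

lemma gain_zero : gain D 0 = 0 := if_neg (lt_irrefl _)

variable [IsProbabilityMeasure D]

lemma survival_quantile (hD : HasMonotoneHazardRate D) {q : ℝ} (h0 : 0 < q) (h1 : q < 1) :
    survival D (quantile D q) = 1 - q := by
  have hc : Continuous (cdf D) := by
    rw [show (cdf D : ℝ → ℝ) = fun x => 1 - survival D x from funext fun x => by simp [survival]]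
    exact continuous_const.sub hD.continuous_survival
  obtain ⟨a, ha⟩ := ((tendsto_cdf_atBot D).eventually (gt_mem_nhds h0)).exists
  obtain ⟨b, hb⟩ := ((tendsto_cdf_atTop D).eventually (lt_mem_nhds h1)).exists
  have hbdd : BddBelow {x | q ≤ cdf D x} := ⟨a, fun x hx =>
    le_of_not_gt fun hlt => (ha.trans_le hx).not_ge (monotone_cdf D hlt.le)⟩
  have hclosed : IsClosed {x | q ≤ cdf D x} := isClosed_le continuous_const hc
  have hmem : q ≤ cdf D (quantile D q) := hclosed.csInf_mem ⟨b, hb.le⟩ hbdd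
  obtain ⟨c, hc'⟩ := mem_range_of_exists_le_of_exists_ge hc ⟨a, ha.le⟩ ⟨b, hb.le⟩
  have hle : cdf D (quantile D q) ≤ q :=
    (monotone_cdf D (csInf_le hbdd hc'.ge : quantile D q ≤ c)).trans hc'.le
  rw [survival, le_antisymm hle hmem]

lemma survival_threshold (hD : HasMonotoneHazardRate D) (h0 : D (Set.Iio 0) = 0) {x : ℝ}
    (hx0 : 0 < x) (hx1 : x ≤ 1) : survival D (threshold D x) = x := by
  unfold threshold
  split_ifs with h
  · rw [survival_quantile hD (by linarith) (by linarith)]; ring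
  · rw [survival_of_nonpos hD h0 le_rfl]; linarith

lemma threshold_nonneg (hD : HasMonotoneHazardRate D) (h0 : D (Set.Iio 0) = 0) {x : ℝ}
    (hx0 : 0 < x) : 0 ≤ threshold D x := by
  rcases lt_or_ge x 1 with h | h
  · by_contra hneg
    have := survival_threshold hD h0 hx0 h.le
    rw [survival_of_nonpos hD h0 (not_le.1 hneg).le] at this
    linarith
  · rw [threshold, if_neg h.not_gt]

lemma threshold_anti (hD : HasMonotoneHazardRate D) (h0 : D (Set.Iio 0) = 0) {x y : ℝ}
    (hx0 : 0 < x) (hxy : x ≤ y) : threshold D y ≤ threshold D x := by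
  rcases lt_or_ge y 1 with h | h
  · by_contra! hlt
    have := survival_antitone (D := D) hlt.le
    rw [survival_threshold hD h0 hx0 (hxy.trans h.le),
      survival_threshold hD h0 (hx0.trans_le hxy) h.le] at this
    rw [le_antisymm hxy this] at hlt
    exact lt_irrefl _ hlt
  · rw [threshold, if_neg h.not_gt]
    exact threshold_nonneg hD h0 hx0

lemma gain_nonneg (hD : HasMonotoneHazardRate D) (h0 : D (Set.Iio 0) = 0) (x : ℝ) :
    0 ≤ gain D x := by
  unfold gain
  split_ifs with h
  · exact upperMean_nonneg (threshold_nonneg hD h0 h)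
  · rfl

lemma gain_mono (hD : HasMonotoneHazardRate D) (h0 : D (Set.Iio 0) = 0) {x y : ℝ}
    (hx0 : 0 < x) (hxy : x ≤ y) : gain D x ≤ gain D y := by
  rw [gain, gain, if_pos hx0, if_pos (hx0.trans_le hxy)]
  exact upperMean_anti (hD.integrable_id h0) (threshold_nonneg hD h0 (hx0.trans_le hxy))
    (threshold_anti hD h0 hx0 hxy)

lemma gain_mul_le (hD : HasMonotoneHazardRate D) (h0 : D (Set.Iio 0) = 0) {x y : ℝ}
    (hx0 : 0 < x) (hxy : x ≤ y) (hy : y ≤ 1) : gain D y * x ≤ gain D x * y := by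
  rw [gain, gain, if_pos hx0, if_pos (hx0.trans_le hxy)]
  have := upperMean_mul_survival_le (hD.integrable_id h0) (threshold_anti hD h0 hx0 hxy)
  rwa [survival_threshold hD h0 hx0 (hxy.trans hy),
    survival_threshold hD h0 (hx0.trans_le hxy) hy] at this

lemma gain_mul_log_le (hD : HasMonotoneHazardRate D) (h0 : D (Set.Iio 0) = 0) {x y : ℝ}
    (hx0 : 0 < x) (hxy : x ≤ y) (hy : y ≤ 1) :
    gain D x * y * -Real.log y ≤ gain D y * x * -Real.log x := by
  rw [gain, gain, if_pos hx0, if_pos (hx0.trans_le hxy)]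
  have hsx := survival_threshold hD h0 hx0 (hxy.trans hy)
  have hsy := survival_threshold hD h0 (hx0.trans_le hxy) hy
  have := upperMean_mul_log_le hD h0 (threshold_nonneg hD h0 (hx0.trans_le hxy))
    (threshold_anti hD h0 hx0 hxy) (hsx.symm ▸ hx0)
  rwa [hsx, hsy] at this

/-- A lower bound of `gain` by a quadratic function, which reduces the analysis of the mechanism
to the first two moments of the fraction `y` of unsold items. Here `x` is the initial fraction; the
bound is the linear extrapolation `gain x * (y / x)`, up to an error that is small relative to
`1 - log x`. The free parameter `σ` is to be the standard deviation of `y / x`. -/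
lemma gain_ge_quadratic (hD : HasMonotoneHazardRate D) (h0 : D (Set.Iio 0) = 0) {x y σ : ℝ}
    (hx0 : 0 < x) (hx1 : x ≤ 1) (hy0 : 0 ≤ y) (hy1 : y ≤ 1) (hσ : 0 < σ) :
    gain D x * (y / x - 2 / (1 - Real.log x) * ((σ * (y / x) + (y / x - 1) ^ 2 / σ) / 2)) ≤
      gain D y := by
  have hs : 0 ≤ -Real.log x := neg_nonneg.2 (Real.log_nonpos hx0.le hx1)
  have hg := gain_nonneg hD h0 x
  set s := -Real.log x with hs_def
  rw [show 1 - Real.log x = 1 + s by rw [hs_def]; ring]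
  set r := y / x with hr
  have hr0 : 0 ≤ r := by positivity
  have hy : y = r * x := by rw [hr]; field_simp
  rcases le_or_gt y x with hyx | hxy
  · have herr : 0 ≤ 2 / (1 + s) * ((σ * r + (r - 1) ^ 2 / σ) / 2) := by positivity
    have hlin : gain D x * r ≤ gain D y := by
      rcases hy0.eq_or_lt with h | h
      · rw [hr, ← h]; simp [gain_zero]
      · rw [hr, ← mul_div_assoc, div_le_iff₀ hx0]
        exact gain_mul_le hD h0 h hyx hx1
    nlinarith [mul_nonneg hg herr]
  · have hr1 : 1 ≤ r := (one_le_div hx0).2 hxy.le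
    have hrpos : 0 < r := zero_lt_one.trans_le hr1
    set L := Real.log r with hL
    have hL0 : 0 ≤ L := Real.log_nonneg hr1
    have hlogy : -Real.log y = s - L := by
      rw [hL, hr, Real.log_div (hx0.trans hxy).ne' hx0.ne', hs_def]; ring
    -- `log r ≤ (r - 1) / √r`, which is `log u ≤ sinh (log u)` for `u = √r`
    have hLr : r * L ≤ (σ * r + (r - 1) ^ 2 / σ) / 2 := by
      set u := Real.sqrt r with hu
      have hu1 : 1 ≤ u := Real.one_le_sqrt.2 hr1
      have hu0 : 0 < u := zero_lt_one.trans_le hu1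
      have huu : r = u ^ 2 := (Real.sq_sqrt hr0).symm
      have hlog : L = 2 * Real.log u := by rw [hL, huu, Real.log_pow]; norm_num
      have hsinh := Real.self_le_sinh_iff.2 (Real.log_nonneg hu1)
      rw [Real.sinh_log hu0] at hsinh
      have h1 : r * L ≤ u * (r - 1) := by
        calc r * L ≤ r * (u - u⁻¹) := by gcongr; linarith
          _ = u * (r - 1) := by rw [huu]; field_simp
      have h2 : 2 * (u * (r - 1)) ≤ σ * r + (r - 1) ^ 2 / σ := by
        have : σ * r + (r - 1) ^ 2 / σ - 2 * (u * (r - 1)) = (σ * u - (r - 1)) ^ 2 / σ := by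
          rw [huu]; field_simp; ring
        have : 0 ≤ (σ * u - (r - 1)) ^ 2 / σ := by positivity
        linarith
      linarith
    have h1 : gain D x * (r * (1 - L)) ≤ gain D y := by
      refine le_trans ?_ (gain_mono hD h0 hx0 hxy.le)
      have : r * (1 - L) ≤ 1 := by
        have := Real.one_sub_inv_le_log_of_pos hrpos
        calc r * (1 - L) ≤ r * r⁻¹ := by gcongr; linarith
          _ = 1 := mul_inv_cancel₀ hrpos.ne'
      nlinarith
    have h2 : gain D x * (r * (s - L)) ≤ gain D y * s := by
      have := gain_mul_log_le hD h0 hx0 hxy.le hy1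
      rw [hlogy, ← hs_def] at this
      refine le_of_mul_le_mul_right ?_ hx0
      calc gain D x * (r * (s - L)) * x = gain D x * y * (s - L) := by rw [hy]; ring
        _ ≤ _ := this
        _ = _ := by ring
    calc gain D x * (r - 2 / (1 + s) * ((σ * r + (r - 1) ^ 2 / σ) / 2))
        ≤ gain D x * (r - 2 / (1 + s) * (r * L)) := by gcongr
      _ = (gain D x * (r * (1 - L)) + gain D x * (r * (s - L))) / (1 + s) := by
          field_simp; ring
      _ ≤ (gain D y + gain D y * s) / (1 + s) := by gcongr
      _ = gain D y := by field_simp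

end Threshold

/-! ### Sorted multipliers -/

section Sorted

lemma List.le_getD_iff_lt_countP {θ : ℝ} (hθ : 0 < θ) (l : List ℝ) (hl : l.Pairwise (· ≥ ·))
    (r : ℕ) : θ ≤ l.getD r 0 ↔ r < l.countP (θ ≤ ·) := by
  induction l generalizing r with
  | nil => simpa using hθ
  | cons x l ih =>
    rw [List.pairwise_cons] at hl
    by_cases hx : θ ≤ x
    · rw [List.countP_cons_of_pos (by simpa using hx)]
      cases r with
      | zero => simpa using hx
      | succ r => rw [List.getD_cons_succ, ih hl.2]; omega
    · have h0 : l.countP (θ ≤ ·) = 0 := by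
        rw [List.countP_eq_zero]
        intro a ha
        simpa using (hl.1 a ha).trans_lt (not_le.1 hx)
      rw [List.countP_cons_of_neg (by simpa using hx), h0]
      cases r with
      | zero => simpa using hx
      | succ r => rw [List.getD_cons_succ, ih hl.2, h0]; simp

variable {m : ℕ} {α : Fin m → ℝ} {M : Finset (Fin m)}

/-- The number of items of `M` whose multiplier is at least `θ`. -/
noncomputable def countGE (α : Fin m → ℝ) (M : Finset (Fin m)) (θ : ℝ) : ℕ :=
  (M.filter fun j => θ ≤ α j).card

/-- The level sets of the sorted multipliers. -/
lemma le_kthMultiplier_iff {θ : ℝ} (hθ : 0 < θ) {r : ℕ} (hr : 1 ≤ r) :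
    θ ≤ kthMultiplier α M r ↔ r ≤ countGE α M θ := by
  rw [kthMultiplier, List.le_getD_iff_lt_countP hθ _ (Multiset.pairwise_sort _ _)]
  have : ((M.val.map α).sort (· ≥ ·)).countP (θ ≤ ·) = countGE α M θ := by
    rw [← Multiset.coe_countP, Multiset.sort_eq, Multiset.countP_map, countGE, Finset.card,
      Finset.filter_val]
  rw [this]; omega

lemma kthMultiplier_nonneg (hα : ∀ j, 0 ≤ α j) (r : ℕ) : 0 ≤ kthMultiplier α M r := by
  unfold kthMultiplier
  rcases lt_or_ge (r - 1) ((M.val.map α).sort (· ≥ ·)).length with h | h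
  · rw [List.getD_eq_getElem _ _ h]
    have := List.getElem_mem h
    rw [Multiset.mem_sort, Multiset.mem_map] at this
    obtain ⟨j, -, hj⟩ := this
    exact hj ▸ hα j
  · rw [List.getD_eq_default _ _ h]

lemma eq_of_forall_pos_le_iff {a b : ℝ} (ha : 0 ≤ a) (hb : 0 ≤ b)
    (h : ∀ θ, 0 < θ → (θ ≤ a ↔ θ ≤ b)) : a = b := by
  apply le_antisymm
  · rcases ha.eq_or_lt with h0 | h0
    · rwa [← h0]
    · exact (h a h0).1 le_rfl
  · rcases hb.eq_or_lt with h0 | h0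
    · rwa [← h0]
    · exact (h b h0).2 le_rfl

lemma kthMultiplier_anti (hα : ∀ j, 0 ≤ α j) {r r' : ℕ} (hr : 1 ≤ r) (h : r ≤ r') :
    kthMultiplier α M r' ≤ kthMultiplier α M r := by
  rcases (kthMultiplier_nonneg (M := M) hα r').eq_or_lt with h0 | h0
  · rw [← h0]; exact kthMultiplier_nonneg hα r
  · rw [le_kthMultiplier_iff h0 hr]
    exact h.trans ((le_kthMultiplier_iff h0 (hr.trans h)).1 le_rfl)

lemma kthMultiplier_of_card_lt {r : ℕ} (h : M.card < r) : kthMultiplier α M r = 0 := by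
  rw [kthMultiplier, List.getD_eq_default]
  simp; omega

lemma one_le_position {j : Fin m} (hj : j ∈ M) : 1 ≤ position α M j :=
  Finset.card_pos.2 ⟨j, by simp [hj]⟩

lemma position_le_card (j : Fin m) : position α M j ≤ M.card :=
  Finset.card_le_card (Finset.filter_subset _ _)

lemma kthMultiplier_position (hα : ∀ j, 0 ≤ α j) {j : Fin m} (hj : j ∈ M) :
    kthMultiplier α M (position α M j) = α j := by
  refine eq_of_forall_pos_le_iff (kthMultiplier_nonneg hα _) (hα j) fun θ hθ => ?_
  rw [le_kthMultiplier_iff hθ (one_le_position hj)]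
  constructor
  · intro h
    by_contra! hlt
    refine h.not_gt (Finset.card_lt_card ⟨fun j' hj' => ?_, fun hsub => ?_⟩)
    · rw [Finset.mem_filter] at hj' ⊢
      exact ⟨hj'.1, Or.inl (hlt.trans_le hj'.2)⟩
    · have : j ∈ M.filter fun j => θ ≤ α j := hsub (by simp [hj])
      exact hlt.not_ge (Finset.mem_filter.1 this).2
  · intro h
    refine Finset.card_le_card fun j' hj' => ?_
    rw [Finset.mem_filter] at hj' ⊢
    refine ⟨hj'.1, h.trans ?_⟩
    rcases hj'.2 with h1 | h1
    · exact h1.le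
    · exact h1.1.ge

lemma position_injOn : Set.InjOn (position α M) M := by
  have key : ∀ j ∈ M, ∀ j' ∈ M, (α j < α j' ∨ (α j' = α j ∧ j' < j)) →
      position α M j' < position α M j := by
    intro j hj j' hj' h
    refine Finset.card_lt_card ⟨fun k hk => ?_, fun hsub => ?_⟩
    · rw [Finset.mem_filter] at hk ⊢
      refine ⟨hk.1, ?_⟩
      rcases h with h | h <;> rcases hk.2 with h2 | h2
      · exact Or.inl (h.trans h2)
      · exact Or.inl (h2.1 ▸ h)
      · exact Or.inl (h.1 ▸ h2)
      · exact Or.inr ⟨h2.1.trans h.1, h2.2.trans h.2.le⟩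
    · have := hsub (show j ∈ _ by simp [hj])
      rw [Finset.mem_filter] at this
      rcases h with h | h <;> rcases this.2 with h2 | h2
      · exact lt_asymm h h2
      · exact h.ne h2.1
      · exact h2.ne h.1
      · exact h2.2.not_gt h.2
  intro j hj j' hj' h
  by_contra hne
  rcases lt_trichotomy (α j) (α j') with h1 | h1 | h1
  · exact (key j hj j' hj' (Or.inl h1)).ne' h
  · rcases lt_or_gt_of_ne hne with h2 | h2
    · exact (key j' hj' j hj (Or.inr ⟨h1, h2⟩)).ne h
    · exact (key j hj j' hj' (Or.inr ⟨h1.symm, h2⟩)).ne' h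
  · exact (key j' hj' j hj (Or.inl h1)).ne h

lemma exists_position_eq {r : ℕ} (hr : 1 ≤ r) (hrM : r ≤ M.card) :
    ∃ j ∈ M, position α M j = r := by
  have himg : M.image (position α M) = Finset.Icc 1 M.card := by
    refine Finset.eq_of_subset_of_card_le (fun k hk => ?_) ?_
    · obtain ⟨j, hj, rfl⟩ := Finset.mem_image.1 hk
      exact Finset.mem_Icc.2 ⟨one_le_position hj, position_le_card j⟩
    · rw [Finset.card_image_of_injOn position_injOn]; simp
  have : r ∈ M.image (position α M) := himg ▸ Finset.mem_Icc.2 ⟨hr, hrM⟩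
  simpa using this

end Sorted

/-! ### Demand under the quantile prices -/

/-- The position of the item that a buyer of type `t` demands when `N` buyers remain: the first
`r ≥ 1` such that `t` exceeds the threshold for selling with probability `r / N`, and `N` if there
is no such `r < N`. -/
noncomputable def demand (D : Measure ℝ) (N : ℕ) (t : ℝ) : ℕ :=
  sInf {r | 1 ≤ r ∧ (N ≤ r ∨ threshold D (r / N) < t)}

/-- The utility of a buyer of type `t` for the item in position `r`; it is `0` for positions beyond
the number of items. -/
noncomputable def utilityAt {m : ℕ} (D : Measure ℝ) (α : Fin m → ℝ) (M : Finset (Fin m)) (N : ℕ)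
    (t : ℝ) (r : ℕ) : ℝ :=
  kthMultiplier α M r * t - ∑ k ∈ Finset.Ico r N,
    (kthMultiplier α M k - kthMultiplier α M (k + 1)) * threshold D (k / N)

/-- A positive type that is none of the thresholds in the prices for `N` remaining buyers. A buyer of
such a type is indifferent between two items of maximal utility only if their multipliers agree. -/
def IsGeneric (D : Measure ℝ) (N : ℕ) (t : ℝ) : Prop :=
  0 < t ∧ ∀ k : ℕ, 1 ≤ k → k < N → t ≠ threshold D (k / N)

lemma threshold_natCast_div {D : Measure ℝ} {N k : ℕ} (hN : 0 < N) (h : N ≤ k) :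
    threshold D (k / N) = 0 := by
  have : (1 : ℝ) ≤ k / N := by
    rw [one_le_div (by positivity)]; exact_mod_cast h
  rw [threshold, if_neg this.not_gt]

section Demand

variable {D : Measure ℝ}

lemma demand_mem (N : ℕ) (t : ℝ) :
    1 ≤ demand D N t ∧ (N ≤ demand D N t ∨ threshold D (demand D N t / N) < t) :=
  Nat.sInf_mem (s := {r | 1 ≤ r ∧ (N ≤ r ∨ threshold D (r / N) < t)})
    ⟨N + 1, by omega, Or.inl (by omega)⟩

lemma demand_le {N r : ℕ} {t : ℝ} (hr : 1 ≤ r) (h : N ≤ r ∨ threshold D (r / N) < t) :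
    demand D N t ≤ r := Nat.sInf_le ⟨hr, h⟩

lemma demand_le_self {N : ℕ} (hN : 0 < N) (t : ℝ) : demand D N t ≤ N :=
  demand_le hN (Or.inl le_rfl)

variable [IsProbabilityMeasure D] (hD : HasMonotoneHazardRate D) (h0 : D (Set.Iio 0) = 0)

include hD h0

lemma demand_le_iff_of_lt {N K : ℕ} (hK : 1 ≤ K) (hKN : K < N) (t : ℝ) :
    demand D N t ≤ K ↔ threshold D (K / N) < t := by
  refine ⟨fun h => ?_, fun h => demand_le hK (Or.inr h)⟩
  obtain ⟨h1, h2⟩ := demand_mem (D := D) N t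
  rcases h2 with h2 | h2
  · omega
  · refine lt_of_le_of_lt (threshold_anti hD h0 ?_ ?_) h2
    · have : 0 < N := by omega
      positivity
    · gcongr

lemma demand_le_iff {N K : ℕ} (hN : 0 < N) {t : ℝ} (ht : 0 < t) :
    demand D N t ≤ K ↔ 0 < K ∧ threshold D (K / N) < t := by
  rcases Nat.eq_zero_or_pos K with rfl | hK
  · have := (demand_mem (D := D) N t).1
    simp; omega
  rcases lt_or_ge K N with h | h
  · rw [demand_le_iff_of_lt hD h0 hK h]; simp [hK]
  · rw [threshold_natCast_div hN h]
    exact ⟨fun _ => ⟨hK, ht⟩, fun _ => (demand_le_self hN t).trans h⟩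

variable {m : ℕ} {α : Fin m → ℝ} (hα : ∀ j, 0 ≤ α j) {M : Finset (Fin m)}

omit [IsProbabilityMeasure D] hD h0 in
lemma utilityAt_sub {N : ℕ} (hN : 0 < N) (t : ℝ) (r : ℕ) :
    utilityAt D α M N t r - utilityAt D α M N t (r + 1) =
      (kthMultiplier α M r - kthMultiplier α M (r + 1)) * (t - threshold D (r / N)) := by
  unfold utilityAt
  rcases lt_or_ge r N with h | h
  · rw [Finset.sum_eq_sum_Ico_succ_bot h]; ring
  · rw [Finset.Ico_eq_empty_of_le h, Finset.Ico_eq_empty_of_le (by omega),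
      threshold_natCast_div hN h]
    simp; ring

omit [IsProbabilityMeasure D] hD h0 in
lemma utilityAt_of_card_lt (N : ℕ) (t : ℝ) {r : ℕ} (hr : M.card < r) :
    utilityAt D α M N t r = 0 := by
  rw [utilityAt, kthMultiplier_of_card_lt hr, Finset.sum_eq_zero]
  · simp
  · intro k hk
    have := (Finset.mem_Ico.1 hk).1
    rw [kthMultiplier_of_card_lt (by omega), kthMultiplier_of_card_lt (by omega)]
    simp

include hα

/-- The utility is maximal in the demanded position, and all positions of maximal utility have the
same multiplier. -/
lemma utilityAt_le_demand {N : ℕ} (hN : 0 < N) {t : ℝ} (ht : IsGeneric D N t) {r : ℕ}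
    (hr : 1 ≤ r) :
    utilityAt D α M N t r ≤ utilityAt D α M N t (demand D N t) ∧
      (utilityAt D α M N t r = utilityAt D α M N t (demand D N t) →
        kthMultiplier α M r = kthMultiplier α M (demand D N t)) := by
  have hδ : ∀ k, 1 ≤ k → 0 ≤ kthMultiplier α M k - kthMultiplier α M (k + 1) := fun k hk =>
    sub_nonneg.2 (kthMultiplier_anti hα hk (Nat.le_succ k))
  rcases le_total (demand D N t) r with h | h
  · induction r, h using Nat.le_induction with
    | base => simp
    | succ r h ih =>
      obtain ⟨ih1, ih2⟩ := ih ((demand_mem N t).1.trans h)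
      have hs := utilityAt_sub (D := D) (α := α) (M := M) hN t r
      have hr1 := (demand_mem (D := D) N t).1.trans h
      have hq : 0 < t - threshold D (r / N) :=
        sub_pos.2 ((demand_le_iff hD h0 hN ht.1).1 h).2
      have hd := hδ r hr1
      refine ⟨by nlinarith, fun heq => ?_⟩
      have hz : (kthMultiplier α M r - kthMultiplier α M (r + 1)) *
          (t - threshold D (r / N)) = 0 := le_antisymm (by linarith) (by positivity)
      rw [← ih2 (by linarith)]
      rcases mul_eq_zero.1 hz with hz | hz
      · linarith
      · exact absurd hz hq.ne'
  · induction h using Nat.decreasingInduction with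
    | self => simp
    | of_succ r h ih =>
      obtain ⟨ih1, ih2⟩ := ih (by omega)
      have hs := utilityAt_sub (D := D) (α := α) (M := M) hN t r
      have hrN : r < N := h.trans_le (demand_le_self hN t)
      have hq : 0 < threshold D (r / N) - t := by
        refine sub_pos.2 (lt_of_le_of_ne ?_ (ht.2 r hr hrN))
        by_contra! hlt
        exact h.not_ge (demand_le hr (Or.inr hlt))
      have hd := hδ r hr
      refine ⟨by nlinarith, fun heq => ?_⟩
      have hz : (kthMultiplier α M r - kthMultiplier α M (r + 1)) *
          (threshold D (r / N) - t) = 0 := le_antisymm (by linarith) (by positivity)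
      rw [← ih2 (by linarith)]
      rcases mul_eq_zero.1 hz with hz | hz
      · linarith
      · exact absurd hz hq.ne'

/-- The maximal utility is that of the demanded position, which is nonnegative because positions
beyond the number of items have utility `0`. -/
lemma utilityAt_demand_nonneg {N : ℕ} (hN : 0 < N) {t : ℝ} (ht : IsGeneric D N t) :
    0 ≤ utilityAt D α M N t (demand D N t) ∧
      (utilityAt D α M N t (demand D N t) = 0 → kthMultiplier α M (demand D N t) = 0) := by
  have h := utilityAt_le_demand hD h0 hα (M := M) hN ht (r := M.card + 1) (by omega)
  rw [utilityAt_of_card_lt _ _ (Nat.lt_succ_self _),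
    kthMultiplier_of_card_lt (Nat.lt_succ_self _)] at h
  exact ⟨h.1, fun h' => (h.2 h'.symm).symm⟩

omit [IsProbabilityMeasure D] hD h0 in
lemma separable_sub_quantilePrices {n : ℕ} (t : Fin n → ℝ) (i : Fin n) {j : Fin m} (hj : j ∈ M) :
    separable α t i j - quantilePrices n D α i M j =
      utilityAt D α M (n - i) (t i) (position α M j) := by
  unfold separable quantilePrices utilityAt
  rw [kthMultiplier_position hα hj]
  congr 1
  refine Finset.sum_congr rfl fun k hk => ?_
  have hk := (Finset.mem_Ico.1 hk).2
  have hi : ((n - i : ℕ) : ℝ) = (n : ℝ) - (i : ℕ) := Nat.cast_sub i.2.le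
  have hN : (0 : ℝ) < (n - i : ℕ) := by exact_mod_cast (by omega : 0 < n - i)
  rw [threshold, if_pos, hi]
  rw [div_lt_one hN]; exact_mod_cast hk

/-- However ties are broken, a buyer without relevant ties obtains the multiplier in the demanded
position (where obtaining nothing and obtaining an item with multiplier `0` are not
distinguished). -/
lemma IsOutcome.elim_eq_kthMultiplier {n : ℕ} {t : Fin n → ℝ} {A : Allocation n m}
    (hA : IsOutcome (quantilePrices n D α) (separable α t) A) (i : Fin n)
    (ht : IsGeneric D (n - i) (t i)) :
    (A i).elim 0 α = kthMultiplier α (remaining A i) (demand D (n - i) (t i)) := by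
  have hN : 0 < n - (i : ℕ) := by omega
  set M := remaining A i with hM
  set R := demand D (n - i) (t i) with hR
  have hR1 : 1 ≤ R := (demand_mem _ _).1
  obtain ⟨hnn, hz⟩ := utilityAt_demand_nonneg hD h0 hα (M := M) hN ht
  have hsome := (hA i).1
  have hnone := (hA i).2
  have hu := fun j (hj : j ∈ M) => separable_sub_quantilePrices (D := D) hα t i hj
  rcases hAi : A i with _ | j
  · rw [Option.elim_none]
    rcases le_or_gt R M.card with hRM | hRM
    · obtain ⟨j, hj, hjR⟩ := exists_position_eq (α := α) hR1 hRM
      have h := hnone hAi j hj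
      rw [hu j hj, hjR] at h
      exact (hz (le_antisymm h hnn)).symm
    · exact (kthMultiplier_of_card_lt hRM).symm
  · obtain ⟨hj, hpos, hmax⟩ := hsome j hAi
    rw [Option.elim_some, ← kthMultiplier_position hα hj]
    obtain ⟨hle, heq⟩ := utilityAt_le_demand hD h0 hα (M := M) hN ht (one_le_position (α := α) hj)
    refine heq (le_antisymm hle ?_)
    rw [← hM, hu j hj] at hpos
    rcases le_or_gt R M.card with hRM | hRM
    · obtain ⟨j', hj', hjR⟩ := exists_position_eq (α := α) hR1 hRM
      have h := hmax j' hj'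
      rwa [← hM, hu j hj, hu j' hj', hjR] at h
    · rwa [utilityAt_of_card_lt _ _ hRM]

/-- Buying the item in the demanded position is consistent with the mechanism. -/
lemma isOutcome_of_position_eq_demand {n : ℕ} {t : Fin n → ℝ} {A : Allocation n m}
    (ht : ∀ i : Fin n, IsGeneric D (n - i) (t i))
    (hA : ∀ i, ∃ j ∈ remaining A i, A i = some j ∧
      position α (remaining A i) j = demand D (n - i) (t i)) :
    IsOutcome (quantilePrices n D α) (separable α t) A := by
  intro i
  have hN : 0 < n - (i : ℕ) := by omega
  obtain ⟨j, hj, hAj, hpos⟩ := hA i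
  refine ⟨fun j' hj' => ?_, fun h => by simp [hAj] at h⟩
  obtain rfl : j = j' := by simpa [hAj] using hj'
  refine ⟨hj, ?_, fun j' hj' => ?_⟩
  · rw [separable_sub_quantilePrices hα t i hj, hpos]
    exact (utilityAt_demand_nonneg hD h0 hα hN (ht i)).1
  · rw [separable_sub_quantilePrices hα t i hj, separable_sub_quantilePrices hα t i hj', hpos]
    exact (utilityAt_le_demand hD h0 hα hN (ht i) (one_le_position hj')).1

end Demand

/-! ### The number of unsold items of high multiplier -/

/-- The number of sales to a buyer of type `t`, when `N` buyers remain, out of the `K` best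
remaining items. -/
noncomputable def sale (D : Measure ℝ) (N K : ℕ) (t : ℝ) : ℕ := if demand D N t ≤ K then 1 else 0

/-- The number of items that are unsold when buyer `i` arrives, out of the `k` best items. -/
noncomputable def unsold (D : Measure ℝ) {n : ℕ} (k : ℕ) (t : Fin n → ℝ) : ℕ → ℕ
  | 0 => k
  | i + 1 => unsold D k t i -
      if h : i < n then sale D (n - i) (unsold D k t i) (t ⟨i, h⟩) else 0

section Chain

variable {D : Measure ℝ} {n k : ℕ}

lemma unsold_succ (t : Fin n → ℝ) (i : Fin n) :
    unsold D k t (i + 1) = unsold D k t i - sale D (n - i) (unsold D k t i) (t i) := by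
  rw [unsold, dif_pos i.2]

lemma sale_le (N K : ℕ) (t : ℝ) : sale D N K t ≤ K := by
  unfold sale
  split_ifs with h
  · exact (demand_mem N t).1.trans h
  · exact Nat.zero_le _

lemma unsold_le (hk : k ≤ n) (t : Fin n → ℝ) : ∀ i ≤ n, unsold D k t i ≤ n - i := by
  intro i
  induction i with
  | zero => intro _; simpa [unsold] using hk
  | succ i ih =>
    intro hi
    have h := ih (by omega)
    rw [unsold, dif_pos (by omega : i < n)]
    rcases h.lt_or_eq with h1 | h1
    · omega
    · rw [sale, if_pos (h1 ▸ demand_le_self (by omega) _)]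
      omega

lemma unsold_congr {t t' : Fin n → ℝ} {i : ℕ} (h : ∀ j : Fin n, (j : ℕ) < i → t j = t' j) :
    unsold D k t i = unsold D k t' i := by
  induction i with
  | zero => rfl
  | succ i ih =>
    rw [unsold, unsold, ih fun j hj => h j (by omega)]
    split_ifs with hi
    · rw [h ⟨i, hi⟩ (Nat.lt_succ_self i)]
    · rfl

end Chain

section Independence

lemma ProbabilityTheory.iIndepFun.indepFun_of_forall_lt {Ω β : Type*} [MeasurableSpace Ω]
    [MeasurableSpace β] {P : Measure Ω} {n : ℕ} {t : Fin n → Ω → ℝ} (ht : ∀ i, Measurable (t i))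
    (hind : iIndepFun t P) (i : Fin n) {Z : (Fin n → ℝ) → β} (hZ : Measurable Z)
    (hdep : ∀ u u', (∀ j < i, u j = u' j) → Z u = Z u') :
    IndepFun (fun ω => Z fun j => t j ω) (t i) P := by
  have hdisj : Disjoint (Finset.Iio i) {i} := by simp
  have h := hind.indepFun_finset (Finset.Iio i) {i} hdisj ht
  set e : (Finset.Iio i → ℝ) → Fin n → ℝ := fun u j =>
    if hj : j ∈ Finset.Iio i then u ⟨j, hj⟩ else 0 with he
  have hem : Measurable e := by
    refine measurable_pi_lambda _ fun j => ?_
    by_cases hj : j ∈ Finset.Iio i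
    · simp only [he, hj, dif_pos]; exact measurable_pi_apply _
    · simp only [he, hj, dif_neg, not_false_eq_true]; exact measurable_const
  have h2 := h.comp (hZ.comp hem)
    (measurable_pi_apply (⟨i, by simp⟩ : ({i} : Finset (Fin n))))
  rw [show (fun ω => Z fun j => t j ω) =
    (Z ∘ e) ∘ fun ω (j : Finset.Iio i) => t j ω from ?_]
  · exact h2
  · funext ω
    refine hdep _ _ fun j hj => ?_
    simp [he, hj]

/-- The expectation of a function of a bounded natural random variable and an independent variable
of law `D`. -/
lemma integral_comp_indepFun {Ω : Type*} [MeasurableSpace Ω] {P : Measure Ω}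
    [IsProbabilityMeasure P] {D : Measure ℝ} {κ : Ω → ℕ} {X : Ω → ℝ} (hκ : Measurable κ)
    (hX : Measurable X) (hXD : P.map X = D) (hind : IndepFun κ X P) {n : ℕ} (hn : ∀ ω, κ ω ≤ n)
    {ψ : ℕ → ℝ → ℝ} (hψ : ∀ c, Measurable (ψ c)) (hψi : ∀ c, Integrable (ψ c) D) :
    Integrable (fun ω => ψ (κ ω) (X ω)) P ∧
      ∫ ω, ψ (κ ω) (X ω) ∂P = ∫ ω, (∫ y, ψ (κ ω) y ∂D) ∂P := by
  have hexp : ∀ φ : ℕ → Ω → ℝ, (fun ω => φ (κ ω) ω) =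
      fun ω => ∑ c ∈ Finset.range (n + 1), (if κ ω = c then 1 else 0) * φ c ω := by
    intro φ
    funext ω
    rw [Finset.sum_eq_single (κ ω)]
    · simp
    · intro c _ hc; simp [hc.symm]
    · intro h; exact absurd (Finset.mem_range.2 (Nat.lt_succ_of_le (hn ω))) h
  have hIκ : ∀ c, Measurable fun ω => if κ ω = c then (1 : ℝ) else 0 := fun c =>
    Measurable.ite (hκ (measurableSet_singleton c)) measurable_const measurable_const
  have hψX : ∀ c, Integrable (fun ω => ψ c (X ω)) P := fun c =>
    (hXD ▸ hψi c : Integrable (ψ c) (P.map X)).comp_measurable hX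
  have hint : ∀ (c : ℕ) (φ : Ω → ℝ), Integrable φ P →
      Integrable (fun ω => (if κ ω = c then 1 else 0) * φ ω) P := fun c φ hφ =>
    hφ.bdd_mul (c := 1) (hIκ c).aestronglyMeasurable (Filter.Eventually.of_forall fun ω => by
      split_ifs <;> simp)
  rw [hexp fun c ω => ψ c (X ω), hexp fun c ω => ∫ y, ψ c y ∂D]
  refine ⟨integrable_finsetSum _ fun c _ => hint c _ (hψX c), ?_⟩
  rw [integral_finsetSum _ fun c _ => hint c _ (hψX c),
    integral_finsetSum _ fun c _ => hint c _ (integrable_const _)]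
  refine Finset.sum_congr rfl fun c _ => ?_
  have h := (hind.comp (φ := fun k : ℕ => if k = c then (1 : ℝ) else 0) (ψ := ψ c)
    (measurable_of_countable _) (hψ c)).integral_fun_mul_eq_mul_integral
    (hIκ c).aestronglyMeasurable (hψX c).aestronglyMeasurable
  simp only [Function.comp_apply] at h
  rw [h, integral_mul_const, ← hXD, integral_map hX.aemeasurable (hψ c).aestronglyMeasurable]

end Independence

section Moments

variable {D : Measure ℝ}

lemma measurable_demand (N : ℕ) : Measurable (demand D N) := by
  refine measurable_of_Iic fun r => ?_
  have : demand D N ⁻¹' Set.Iic r =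
      ⋃ k ∈ Set.Icc 1 r, {t | N ≤ k ∨ threshold D (k / N) < t} := by
    ext t
    simp only [Set.mem_preimage, Set.mem_Iic, Set.mem_iUnion, Set.mem_Icc]
    constructor
    · intro h
      exact ⟨demand D N t, ⟨(demand_mem N t).1, h⟩, (demand_mem N t).2⟩
    · rintro ⟨k, ⟨h1, h2⟩, h3⟩
      exact (demand_le h1 h3).trans h2
  rw [this]
  refine MeasurableSet.biUnion (Set.to_countable _) fun k _ => ?_
  by_cases h : N ≤ k
  · simp [h]
  · simp only [h, false_or]; exact measurableSet_Ioi

lemma measurable_sale (N K : ℕ) : Measurable (sale D N K) :=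
  Measurable.ite (measurable_demand N measurableSet_Iic) measurable_const measurable_const

lemma measurable_unsold {n : ℕ} (k i : ℕ) :
    Measurable fun t : Fin n → ℝ => unsold D k t i := by
  induction i with
  | zero => exact measurable_const
  | succ i ih =>
    unfold unsold
    refine ih.sub ?_
    by_cases h : i < n
    · simp only [h, dif_pos]
      exact (measurable_from_prod_countable_right (f := fun p : ℕ × ℝ => sale D (n - i) p.1 p.2)
        fun K => measurable_sale (n - i) K).comp (ih.prodMk (measurable_pi_apply _))
    · simp [h]

lemma ae_pos (hD : HasMonotoneHazardRate D) (h0 : D (Set.Iio 0) = 0) : ∀ᵐ t ∂D, 0 < t := by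
  have := hD.nullSingletonClass
  rw [ae_iff]
  simp only [not_lt]
  rw [← h0]
  exact (Iio_ae_eq_Iic.measure_eq).symm

lemma integrable_sale [IsProbabilityMeasure D] (N K : ℕ) :
    Integrable (fun y => (sale D N K y : ℝ)) D := by
  refine Integrable.of_bound
    ((measurable_of_countable _).comp (measurable_sale N K)).aestronglyMeasurable 1
    (Filter.Eventually.of_forall fun y => ?_)
  unfold sale
  split_ifs <;> simp

lemma integrable_sale_mul (hI : Integrable (fun x => x) D) (N K : ℕ) :
    Integrable (fun y => sale D N K y * y) D := by
  refine hI.bdd_mul (c := 1)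
    ((measurable_of_countable _).comp (measurable_sale N K)).aestronglyMeasurable
    (Filter.Eventually.of_forall fun y => ?_)
  unfold sale
  split_ifs <;> simp

variable [IsProbabilityMeasure D] (hD : HasMonotoneHazardRate D) (h0 : D (Set.Iio 0) = 0)

include hD h0

/-- The demanded position is uniformly distributed. -/
lemma measureReal_demand_le {N K : ℕ} (hN : 0 < N) (hK : K ≤ N) :
    D.real {t | demand D N t ≤ K} = K / N := by
  rcases Nat.eq_zero_or_pos K with rfl | hK0
  · have : {t | demand D N t ≤ 0} = ∅ := by
      ext t; have := (demand_mem (D := D) N t).1; simp; omega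
    rw [this]; simp
  have hN' : (0 : ℝ) < N := by exact_mod_cast hN
  rcases hK.lt_or_eq with h | rfl
  · rw [show {t | demand D N t ≤ K} = Set.Ioi (threshold D (K / N)) from
      Set.ext (demand_le_iff_of_lt hD h0 hK0 h), ← survival_eq_real, survival_threshold hD h0 (by positivity)]
    rw [div_le_one hN']; exact_mod_cast hK
  · simp [demand_le_self hN, hN'.ne']

lemma integral_sale {N K : ℕ} (hN : 0 < N) (hK : K ≤ N) :
    ∫ y, (sale D N K y : ℝ) ∂D = K / N := by
  rw [← measureReal_demand_le hD h0 hN hK, ← integral_indicator_one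
    (show MeasurableSet {t | demand D N t ≤ K} from measurable_demand N measurableSet_Iic)]
  refine integral_congr_ae (Filter.Eventually.of_forall fun y => ?_)
  simp [sale, Set.indicator_apply]

lemma integral_sale_mul {N K : ℕ} (hN : 0 < N) :
    ∫ y, sale D N K y * y ∂D = gain D (K / N) := by
  have h1 : ∀ᵐ y ∂D, (sale D N K y : ℝ) * y =
      if 0 < K then (Set.Ioi (threshold D (K / N))).indicator (fun y => y) y else 0 := by
    filter_upwards [ae_pos hD h0] with y hy
    simp only [sale, demand_le_iff hD h0 hN hy]
    by_cases hK : 0 < K <;> by_cases hy' : threshold D (K / N) < y <;> simp [hK, hy']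
  rw [integral_congr_ae h1, gain]
  have hN' : (0 : ℝ) < N := by exact_mod_cast hN
  rcases Nat.eq_zero_or_pos K with rfl | hK
  · simp
  · rw [if_pos (by positivity)]
    simp only [hK, if_true]
    rw [integral_indicator measurableSet_Ioi, upperMean]

variable {Ω : Type*} [MeasurableSpace Ω] {P : Measure Ω} [IsProbabilityMeasure P] {n k : ℕ}
  {t : Fin n → Ω → ℝ} (ht : ∀ i, Measurable (t i)) (hind : iIndepFun t P)
  (hlaw : ∀ i, P.map (t i) = D) (hk : k ≤ n)

omit [IsProbabilityMeasure D] hD h0 [IsProbabilityMeasure P] in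
include ht in
lemma measurable_unsold_comp (i : ℕ) : Measurable fun ω => unsold D k (fun j => t j ω) i :=
  (measurable_unsold k i).comp (measurable_pi_lambda _ ht)

omit [IsProbabilityMeasure D] hD h0 in
include ht hk in
lemma integrable_comp_unsold {i : ℕ} (hi : i ≤ n) (h : ℕ → ℝ) :
    Integrable (fun ω => h (unsold D k (fun j => t j ω) i)) P := by
  refine Integrable.of_bound ((measurable_of_countable h).comp
    (measurable_unsold_comp ht i)).aestronglyMeasurable
    (∑ c ∈ Finset.range (n + 1), |h c|) (Filter.Eventually.of_forall fun ω => ?_)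
  refine Finset.single_le_sum (f := fun c => |h c|) (fun c _ => abs_nonneg _)
    (Finset.mem_range.2 ?_)
  have := unsold_le (D := D) hk (fun j => t j ω) i hi
  omega

include ht hind hlaw hk

omit [IsProbabilityMeasure D] hD h0 in
lemma integral_unsold_comp (i : Fin n) {ψ : ℕ → ℝ → ℝ} (hψ : ∀ c, Measurable (ψ c))
    (hψi : ∀ c, Integrable (ψ c) D) :
    Integrable (fun ω => ψ (unsold D k (fun j => t j ω) i) (t i ω)) P ∧
      ∫ ω, ψ (unsold D k (fun j => t j ω) i) (t i ω) ∂P =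
        ∫ ω, (∫ y, ψ (unsold D k (fun j => t j ω) i) y ∂D) ∂P := by
  refine integral_comp_indepFun (measurable_unsold_comp ht i) (ht i) (hlaw i)
    (hind.indepFun_of_forall_lt ht i (Z := fun u => unsold D k u i) (measurable_unsold k i)
      fun u u' h => unsold_congr fun j hj => h j hj) (n := n) (fun ω => ?_) hψ hψi
  exact (unsold_le hk _ i i.2.le).trans (Nat.sub_le _ _)

lemma integral_mul_sale (i : Fin n) (h : ℕ → ℝ) :
    Integrable (fun ω => h (unsold D k (fun j => t j ω) i) *
        sale D (n - i) (unsold D k (fun j => t j ω) i) (t i ω)) P ∧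
      ∫ ω, h (unsold D k (fun j => t j ω) i) *
          sale D (n - i) (unsold D k (fun j => t j ω) i) (t i ω) ∂P =
        (∫ ω, h (unsold D k (fun j => t j ω) i) * unsold D k (fun j => t j ω) i ∂P) /
          (n - i : ℕ) := by
  obtain ⟨h1, h2⟩ := integral_unsold_comp ht hind hlaw hk i
    (ψ := fun c y => h c * sale D (n - i) c y)
    (fun c => ((measurable_of_countable _).comp (measurable_sale _ c)).const_mul _)
    (fun c => (integrable_sale _ c).const_mul _)
  refine ⟨h1, h2.trans ?_⟩
  rw [← integral_div]
  congr 1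
  funext ω
  rw [integral_const_mul, integral_sale hD h0 (by omega) (unsold_le hk _ i i.2.le), mul_div_assoc]

/-- The expected welfare from a sale to buyer `i`. -/
lemma integral_sale_mul_type (i : Fin n) :
    Integrable (fun ω => sale D (n - i) (unsold D k (fun j => t j ω) i) (t i ω) * t i ω) P ∧
      ∫ ω, sale D (n - i) (unsold D k (fun j => t j ω) i) (t i ω) * t i ω ∂P =
        ∫ ω, gain D (unsold D k (fun j => t j ω) i / (n - i : ℕ)) ∂P := by
  obtain ⟨h1, h2⟩ := integral_unsold_comp ht hind hlaw hk i
    (ψ := fun c y => sale D (n - i) c y * y)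
    (fun c => ((measurable_of_countable _).comp (measurable_sale _ c)).mul measurable_id)
    (fun c => integrable_sale_mul (hD.integrable_id h0) _ c)
  refine ⟨h1, h2.trans ?_⟩
  congr 1
  funext ω
  rw [integral_sale_mul hD h0 (by omega)]

/-- The expected fraction of unsold items stays `k / n`, because a sale out of `K` items has
probability `K / N`. -/
lemma integral_unsold {i : ℕ} (hi : i ≤ n) :
    ∫ ω, (unsold D k (fun j => t j ω) i : ℝ) ∂P = k * (n - i : ℕ) / n := by
  induction i with
  | zero =>
    have : (n : ℝ) ≠ 0 ∨ k = 0 := by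
      rcases Nat.eq_zero_or_pos n with h | h
      · right; omega
      · left; positivity
    rcases this with h | h
    · simp [unsold, h]
    · simp [unsold, h]
  | succ i ih =>
    have hin : i < n := hi
    have ih := ih hin.le
    obtain ⟨h1, h2⟩ := integral_mul_sale hD h0 ht hind hlaw hk ⟨i, hin⟩ fun _ => 1
    simp only [one_mul] at h1 h2
    have hstep : ∀ ω, (unsold D k (fun j => t j ω) (i + 1) : ℝ) =
        unsold D k (fun j => t j ω) i -
          sale D (n - i) (unsold D k (fun j => t j ω) i) (t ⟨i, hin⟩ ω) := fun ω => by
      rw [← Nat.cast_sub (sale_le _ _ _)]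
      exact congrArg _ (unsold_succ (fun j => t j ω) ⟨i, hin⟩)
    simp only [hstep]
    rw [integral_sub (integrable_comp_unsold ht hk hin.le (fun c => (c : ℝ))) h1, h2, ih]
    have hN : ((n - (i + 1) : ℕ) : ℝ) = (n - i : ℕ) - 1 := by
      rw [← Nat.sub_sub, Nat.cast_sub (by omega)]; simp
    have hN0 : ((n - i : ℕ) : ℝ) ≠ 0 := by
      have : 0 < n - i := by omega
      positivity
    have hn0 : (n : ℝ) ≠ 0 := by
      have : 0 < n := by omega
      positivity
    rw [hN]
    field_simp

/-- The second factorial moment of the number of unsold items: that of a hypergeometric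
distribution. -/
lemma integral_unsold_mul_pred (hn : 2 ≤ n) {i : ℕ} (hi : i ≤ n) :
    ∫ ω, (unsold D k (fun j => t j ω) i : ℝ) * (unsold D k (fun j => t j ω) i - 1) ∂P =
      k * (k - 1) * ((n - i : ℕ) * ((n - i : ℕ) - 1)) / (n * (n - 1)) := by
  have hn0 : (n : ℝ) ≠ 0 := by positivity
  have hn1 : (n : ℝ) - 1 ≠ 0 := by
    have : (2 : ℝ) ≤ n := by exact_mod_cast hn
    linarith
  induction i with
  | zero => simp [unsold]; field_simp
  | succ i ih =>
    have hin : i < n := hi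
    have ih := ih hin.le
    obtain ⟨h1, h2⟩ := integral_mul_sale hD h0 ht hind hlaw hk ⟨i, hin⟩ fun c => 2 * ((c : ℝ) - 1)
    simp only at h1 h2
    have hstep : ∀ ω, (unsold D k (fun j => t j ω) (i + 1) : ℝ) *
          (unsold D k (fun j => t j ω) (i + 1) - 1) =
        unsold D k (fun j => t j ω) i * (unsold D k (fun j => t j ω) i - 1) -
          2 * ((unsold D k (fun j => t j ω) i : ℝ) - 1) *
          sale D (n - i) (unsold D k (fun j => t j ω) i) (t ⟨i, hin⟩ ω) := fun ω => by
      have : (unsold D k (fun j => t j ω) (i + 1) : ℝ) = unsold D k (fun j => t j ω) i -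
          sale D (n - i) (unsold D k (fun j => t j ω) i) (t ⟨i, hin⟩ ω) := by
        rw [← Nat.cast_sub (sale_le _ _ _)]
        exact congrArg _ (unsold_succ (fun j => t j ω) ⟨i, hin⟩)
      rw [this, sale]
      split_ifs <;> push_cast <;> ring
    simp only [hstep]
    rw [integral_sub (integrable_comp_unsold ht hk hin.le (fun c => (c : ℝ) * (c - 1))) h1, h2,
      show (fun ω => 2 * ((unsold D k (fun j => t j ω) i : ℝ) - 1) * unsold D k (fun j => t j ω) i)
        = fun ω => 2 * ((unsold D k (fun j => t j ω) i : ℝ) * (unsold D k (fun j => t j ω) i - 1))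
        from funext fun ω => by ring, integral_const_mul, ih]
    have hN : ((n - (i + 1) : ℕ) : ℝ) = (n - i : ℕ) - 1 := by
      rw [← Nat.sub_sub, Nat.cast_sub (by omega)]; simp
    have hN0 : ((n - i : ℕ) : ℝ) ≠ 0 := by
      have : 0 < n - i := by omega
      positivity
    rw [hN]
    field_simp
    ring

/-- The expected gain at step `i` is at least the gain of the initial fraction `k / n`, up to an
error that is proportional to the relative standard deviation of the fraction of unsold items. -/
lemma integral_gain_ge (hn : 2 ≤ n) (hk0 : 0 < k) (i : Fin n) :
    gain D (k / n) *
        (1 - 2 / (1 - Real.log (k / n)) * (1 / Real.sqrt (k / n * (n - i : ℕ)))) ≤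
      ∫ ω, gain D (unsold D k (fun j => t j ω) i / (n - i : ℕ)) ∂P := by
  have hN : (0 : ℝ) < (n - i : ℕ) := by
    have : 0 < n - (i : ℕ) := by omega
    positivity
  have hn0 : (0 : ℝ) < n := by positivity
  have hk0' : (0 : ℝ) < k := by positivity
  have hkn : (k : ℝ) ≤ n := by exact_mod_cast hk
  set x : ℝ := k / n with hx
  have hx0 : 0 < x := by positivity
  have hx1 : x ≤ 1 := (div_le_one hn0).2 hkn
  set N : ℝ := ((n - i : ℕ) : ℝ) with hNdef
  set σ : ℝ := 1 / Real.sqrt (x * N) with hσ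
  have hσ0 : 0 < σ := by positivity
  have hσ2 : σ ^ 2 = 1 / (x * N) := by
    rw [hσ, div_pow, Real.sq_sqrt (by positivity), one_pow]
  set lam := 2 / (1 - Real.log x)
  have hlam : 0 ≤ lam := by
    have := Real.log_nonpos hx0.le hx1
    have : 0 < 1 - Real.log x := by linarith
    positivity
  have hκi : ∀ h : ℕ → ℝ, Integrable (fun ω => h (unsold D k (fun j => t j ω) i)) P :=
    integrable_comp_unsold ht hk i.2.le
  set κ : Ω → ℝ := fun ω => (unsold D k (fun j => t j ω) i : ℝ) with hκ
  have m1 : ∫ ω, κ ω ∂P = k * N / n := integral_unsold hD h0 ht hind hlaw hk i.2.le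
  have m2 : ∫ ω, κ ω * (κ ω - 1) ∂P = k * (k - 1) * (N * (N - 1)) / (n * (n - 1)) :=
    integral_unsold_mul_pred hD h0 ht hind hlaw hk hn i.2.le
  have i1 : Integrable κ P := hκi fun c => c
  have i2 : Integrable (fun ω => κ ω * (κ ω - 1)) P := hκi fun c => c * (c - 1)
  have e1 : ∫ ω, κ ω / N / x ∂P = 1 := by
    rw [integral_div, integral_div, m1, hx]; field_simp
  have e2 : ∫ ω, (κ ω / N / x - 1) ^ 2 ∂P ≤ σ ^ 2 := by
    have hexp : ∀ ω, (κ ω / N / x - 1) ^ 2 =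
        κ ω * (κ ω - 1) / (N * x) ^ 2 + κ ω * (1 / (N * x) ^ 2 - 2 / (N * x)) + 1 := fun ω => by
      field_simp; ring
    simp only [hexp]
    have i12 : Integrable (fun ω => κ ω * (κ ω - 1) / (N * x) ^ 2 +
        κ ω * (1 / (N * x) ^ 2 - 2 / (N * x))) P := (i2.div_const _).add (i1.mul_const _)
    rw [integral_add i12 (integrable_const _),
      integral_add (i2.div_const _) (i1.mul_const _), integral_div, integral_mul_const, m1, m2,
      integral_const, hσ2]
    have hn1 : (0 : ℝ) < n - 1 := by
      have : (2 : ℝ) ≤ n := by exact_mod_cast hn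
      linarith
    have hmain : k * (k - 1) * (N * (N - 1)) / (n * (n - 1)) / (N * x) ^ 2 ≤ 1 := by
      have hN1 : 1 ≤ N := by
        rw [hNdef]; exact_mod_cast (by omega : 1 ≤ n - (i : ℕ))
      have hk1 : (1 : ℝ) ≤ k := by exact_mod_cast hk0
      have hxn : x * n = k := by rw [hx]; field_simp
      rw [div_div, div_le_one (by positivity)]
      have h3 : (k - 1 : ℝ) * n ≤ k * (n - 1) := by linarith
      have h4 : N * (N - 1) ≤ N ^ 2 := by nlinarith
      calc k * (k - 1) * (N * (N - 1)) ≤ k * (k - 1) * N ^ 2 := by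
            gcongr
        _ = x * N ^ 2 * ((k - 1) * n) := by rw [← hxn]; ring
        _ ≤ x * N ^ 2 * (k * (n - 1)) := by gcongr
        _ = n * (n - 1) * (N * x) ^ 2 := by rw [← hxn]; ring
    have hrest : k * N / n * (1 / (N * x) ^ 2 - 2 / (N * x)) = 1 / (x * N) - 2 := by
      rw [hx]; field_simp
    rw [hrest]
    simp only [probReal_univ, smul_eq_mul, mul_one]
    linarith
  have i3 : Integrable (fun ω => κ ω / N / x) P := (i1.div_const _).div_const _
  have i4 : Integrable (fun ω => (κ ω / N / x - 1) ^ 2) P := hκi fun c => (c / N / x - 1) ^ 2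
  have i5 : Integrable (fun ω => (σ * (κ ω / N / x) + (κ ω / N / x - 1) ^ 2 / σ) / 2) P :=
    ((i3.const_mul _).add (i4.div_const _)).div_const _
  have e3 : ∫ ω, (σ * (κ ω / N / x) + (κ ω / N / x - 1) ^ 2 / σ) / 2 ∂P =
      (σ * 1 + (∫ ω, (κ ω / N / x - 1) ^ 2 ∂P) / σ) / 2 := by
    rw [integral_div, integral_add (i3.const_mul _) (i4.div_const _), integral_const_mul, e1,
      integral_div]
  calc gain D x * (1 - lam * σ)
      ≤ gain D x * (1 - lam * ((σ * 1 + (∫ ω, (κ ω / N / x - 1) ^ 2 ∂P) / σ) / 2)) := by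
        have hle : (∫ ω, (κ ω / N / x - 1) ^ 2 ∂P) / σ ≤ σ := by
          rw [div_le_iff₀ hσ0, ← sq]; exact e2
        have := gain_nonneg hD h0 x
        gcongr
        linarith
    _ = ∫ ω, gain D x * (κ ω / N / x -
          lam * ((σ * (κ ω / N / x) + (κ ω / N / x - 1) ^ 2 / σ) / 2)) ∂P := by
        rw [integral_const_mul, integral_sub i3 (i5.const_mul _), integral_const_mul, e1, e3]
    _ ≤ ∫ ω, gain D (κ ω / N) ∂P := by
        refine integral_mono ((i3.sub (i5.const_mul _)).const_mul _) (hκi fun c => gain D (c / N))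
          fun ω => ?_
        refine gain_ge_quadratic hD h0 hx0 hx1 (by positivity) ?_ hσ0
        rw [div_le_one hN]
        exact Nat.cast_le.2 (unsold_le hk _ i i.2.le)

end Moments

/-! ### The ratio for identical items -/

lemma sum_one_div_sqrt_le (n : ℕ) :
    ∑ i : Fin n, 1 / Real.sqrt ((n - i : ℕ) : ℝ) ≤ 2 * Real.sqrt n := by
  rw [Fin.sum_univ_eq_sum_range fun i => 1 / Real.sqrt ((n - i : ℕ) : ℝ)]
  have hstep : ∀ i ∈ Finset.range n, 1 / Real.sqrt ((n - i : ℕ) : ℝ) ≤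
      2 * Real.sqrt ((n - i : ℕ) : ℝ) - 2 * Real.sqrt ((n - (i + 1) : ℕ) : ℝ) := by
    intro i hi
    have hi := Finset.mem_range.1 hi
    obtain ⟨N, hN⟩ : ∃ N, n - i = N + 1 := ⟨n - i - 1, by omega⟩
    rw [← Nat.sub_sub, hN, Nat.add_sub_cancel]
    have hpos : 0 < Real.sqrt ((N + 1 : ℕ) : ℝ) := Real.sqrt_pos.2 (by positivity)
    have h1 := Real.sq_sqrt (show (0 : ℝ) ≤ (N + 1 : ℕ) by positivity)
    have h2 := Real.sq_sqrt (show (0 : ℝ) ≤ N by positivity)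
    rw [div_le_iff₀ hpos]
    push_cast at *
    nlinarith [sq_nonneg (Real.sqrt ((N : ℝ) + 1) - Real.sqrt N)]
  refine (Finset.sum_le_sum hstep).trans ?_
  rw [Finset.sum_range_sub' fun i => 2 * Real.sqrt ((n - i : ℕ) : ℝ)]
  simp

lemma log_le_mul_sqrt {n k : ℕ} (hk0 : 0 < k) (hkn : k ≤ n) :
    Real.log n ≤ (1 - Real.log (k / n)) * (2 * Real.sqrt k) := by
  have hk : (0 : ℝ) < k := by positivity
  have hn : (0 : ℝ) < n := by exact_mod_cast hk0.trans_le hkn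
  rw [Real.log_div hk.ne' hn.ne']
  have hle : Real.log k ≤ Real.log n := Real.log_le_log hk (by exact_mod_cast hkn)
  have h1 : 1 ≤ Real.sqrt k := Real.one_le_sqrt.2 (by exact_mod_cast hk0)
  have h2 : Real.log k = 2 * Real.log (Real.sqrt k) := by
    rw [Real.log_sqrt hk.le]; ring
  have h3 := Real.log_le_sub_one_of_pos (zero_lt_one.trans_le h1)
  nlinarith

section Identical

variable {D : Measure ℝ} [IsProbabilityMeasure D] (hD : HasMonotoneHazardRate D)
  (h0 : D (Set.Iio 0) = 0) {Ω : Type*} [MeasurableSpace Ω] {P : Measure Ω}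
  [IsProbabilityMeasure P] {n k : ℕ} {t : Fin n → Ω → ℝ} (ht : ∀ i, Measurable (t i))
  (hind : iIndepFun t P) (hlaw : ∀ i, P.map (t i) = D)

include hD h0 ht hind hlaw

/-- The expected welfare from the `k` best items, compared with its upper bound
`n * gain D (k / n)`. -/
lemma sum_integral_sale_mul_type_ge (hn : 2 ≤ n) (hk0 : 0 < k) (hk : k ≤ n) :
    (1 - 8 / Real.log n) * (n * gain D (k / n)) ≤ ∑ i : Fin n,
      ∫ ω, sale D (n - i) (unsold D k (fun j => t j ω) i) (t i ω) * t i ω ∂P := by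
  have hn0 : (0 : ℝ) < n := by positivity
  have hkr : (0 : ℝ) < k := by positivity
  have hlogn : 0 < Real.log n := Real.log_pos (by exact_mod_cast hn)
  have hg := gain_nonneg hD h0 ((k : ℝ) / n)
  have hlx : 0 < 1 - Real.log (k / n) := by
    have := Real.log_nonpos (by positivity : (0 : ℝ) ≤ k / n)
      ((div_le_one hn0).2 (by exact_mod_cast hk))
    linarith
  set g := gain D ((k : ℝ) / n)
  set l := 1 - Real.log ((k : ℝ) / n)
  have hsum : ∑ i : Fin n, 1 / Real.sqrt (k / n * (n - i : ℕ)) ≤ n * (2 / Real.sqrt k) := by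
    have h1 : ∀ i : Fin n, 1 / Real.sqrt (k / n * (n - i : ℕ)) =
        (Real.sqrt n / Real.sqrt k) * (1 / Real.sqrt ((n - i : ℕ) : ℝ)) := fun i => by
      rw [Real.sqrt_mul (by positivity), Real.sqrt_div hkr.le, one_div, mul_inv, inv_div, one_div]
    simp only [h1]
    rw [← Finset.mul_sum]
    calc _ ≤ Real.sqrt n / Real.sqrt k * (2 * Real.sqrt n) := by
          gcongr; exact sum_one_div_sqrt_le n
      _ = Real.sqrt n * Real.sqrt n * (2 / Real.sqrt k) := by ring
      _ = _ := by rw [Real.mul_self_sqrt hn0.le]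
  have hratio : 2 / l * (2 / Real.sqrt k) ≤ 8 / Real.log n := by
    have hsk : 0 < Real.sqrt k := Real.sqrt_pos.2 hkr
    rw [div_mul_div_comm, div_le_div_iff₀ (by positivity) hlogn]
    have := log_le_mul_sqrt hk0 hk
    nlinarith
  calc (1 - 8 / Real.log n) * (n * g) ≤ (1 - 2 / l * (2 / Real.sqrt k)) * (n * g) := by gcongr
    _ = g * (n - 2 / l * (n * (2 / Real.sqrt k))) := by ring
    _ ≤ g * (n - 2 / l * ∑ i : Fin n, 1 / Real.sqrt (k / n * (n - i : ℕ))) := by gcongr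
    _ = ∑ i : Fin n, g * (1 - 2 / l * (1 / Real.sqrt (k / n * (n - i : ℕ)))) := by
        rw [← Finset.mul_sum, Finset.sum_sub_distrib, ← Finset.mul_sum]; simp
    _ ≤ _ := Finset.sum_le_sum fun i _ => by
        rw [(integral_sale_mul_type hD h0 ht hind hlaw hk i).2]
        exact integral_gain_ge hD h0 ht hind hlaw hk hn hk0 i

omit hind in
/-- The upper bound `k q + ∑ (t i - q)⁺` on the sum of any `k` types has expectation
`n * gain D (k / n)` if `q` is the threshold for selling with probability `k / n`. -/
lemma integral_add_sum_max (hk0 : 0 < k) (hk : k ≤ n) :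
    Integrable (fun ω => k * threshold D (k / n) + ∑ i, max (t i ω - threshold D (k / n)) 0) P ∧
      ∫ ω, (k * threshold D (k / n) + ∑ i, max (t i ω - threshold D (k / n)) 0) ∂P =
        n * gain D (k / n) := by
  have hn0 : (0 : ℝ) < n := by exact_mod_cast hk0.trans_le hk
  have hx0 : (0 : ℝ) < k / n := by positivity
  have hx1 : (k : ℝ) / n ≤ 1 := (div_le_one hn0).2 (by exact_mod_cast hk)
  set q := threshold D (k / n) with hq
  have hI := hD.integrable_id h0
  have hmax : Integrable (fun y => max (y - q) 0) D := (hI.sub (integrable_const q)).pos_part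
  have hti : ∀ i, Integrable (fun ω => max (t i ω - q) 0) P := fun i =>
    (hlaw i ▸ hmax : Integrable (fun y => max (y - q) 0) (P.map (t i))).comp_measurable (ht i)
  have hsumi := integrable_finsetSum Finset.univ fun i _ => hti i
  have hint : ∀ i, ∫ ω, max (t i ω - q) 0 ∂P = gain D (k / n) - q * (k / n) := fun i => by
    rw [← integral_map (f := fun y => max (y - q) 0) (ht i).aemeasurable
      (hlaw i ▸ hmax.aestronglyMeasurable), hlaw i, integral_max_sub hI, hq,
      survival_threshold hD h0 hx0 hx1, gain, if_pos hx0]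
  refine ⟨(integrable_const _).add hsumi, ?_⟩
  rw [integral_add (integrable_const _) hsumi, integral_finsetSum _ fun i _ => hti i]
  simp only [hint]
  simp
  field_simp
  ring

end Identical

/-! ### Decomposition of the multipliers into level sets -/

lemma exists_layer_weights (V : Finset ℝ) (hV : ∀ v ∈ V, 0 < v) :
    ∃ w : ℝ → ℝ, (∀ u, 0 ≤ w u) ∧ ∀ v ∈ V, v = ∑ u ∈ V, w u * if u ≤ v then 1 else 0 := by
  induction V using Finset.induction_on_max with
  | empty => exact ⟨0, fun _ => le_rfl, by simp⟩
  | insert a V hmax ih =>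
    obtain ⟨w, hw, hwV⟩ := ih fun v hv => hV v (Finset.mem_insert_of_mem hv)
    have ha : a ∉ V := fun h => lt_irrefl _ (hmax a h)
    have hS : ∑ u ∈ V, w u ≤ a := by
      rcases V.eq_empty_or_nonempty with rfl | hne
      · simpa using (hV a (by simp)).le
      · have hM := V.max'_mem hne
        have : ∑ u ∈ V, w u = V.max' hne := by
          conv_rhs => rw [hwV _ hM]
          refine Finset.sum_congr rfl fun u hu => ?_
          rw [if_pos (V.le_max' u hu), mul_one]
        rw [this]; exact (hmax _ hM).le
    refine ⟨Function.update w a (a - ∑ u ∈ V, w u), fun u => ?_, fun v hv => ?_⟩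
    · rcases eq_or_ne u a with rfl | h
      · simpa using hS
      · simpa [h] using hw u
    · have hcongr : ∀ v, ∑ u ∈ V, Function.update w a (a - ∑ u ∈ V, w u) u *
          (if u ≤ v then (1 : ℝ) else 0) = ∑ u ∈ V, w u * if u ≤ v then 1 else 0 := fun v =>
        Finset.sum_congr rfl fun u hu => by
          rw [Function.update_of_ne (ne_of_mem_of_not_mem hu ha)]
      rw [Finset.sum_insert ha, hcongr, Function.update_self]
      rcases Finset.mem_insert.1 hv with rfl | hv
      · have : ∑ u ∈ V, w u * (if u ≤ v then (1 : ℝ) else 0) = ∑ u ∈ V, w u :=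
          Finset.sum_congr rfl fun u hu => by rw [if_pos (hmax u hu).le, mul_one]
        rw [this]; simp
      · rw [if_neg (hmax v hv).not_ge, mul_zero, zero_add]
        exact hwV v hv

/-- The positive values of the multipliers. -/
noncomputable def levels {m : ℕ} (α : Fin m → ℝ) : Finset ℝ :=
  (Finset.univ.image α).filter (0 < ·)

section Levels

variable {n m : ℕ} {α : Fin m → ℝ}

lemma pos_of_mem_levels {θ : ℝ} (hθ : θ ∈ levels α) : 0 < θ := (Finset.mem_filter.1 hθ).2

lemma countGE_pos_of_mem_levels {θ : ℝ} (hθ : θ ∈ levels α) : 0 < countGE α Finset.univ θ := by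
  obtain ⟨j, -, hj⟩ := Finset.mem_image.1 (Finset.mem_filter.1 hθ).1
  exact Finset.card_pos.2 ⟨j, by simp [hj]⟩

/-- The welfare is a positive combination, over the levels `θ`, of the total types of the buyers
who obtain a multiplier of at least `θ`. -/
lemma exists_welfare_eq (hα : ∀ j, 0 ≤ α j) :
    ∃ w : ℝ → ℝ, (∀ u, 0 ≤ w u) ∧ ∀ (t : Fin n → ℝ) (A : Allocation n m),
      welfare (separable α t) A = ∑ θ ∈ levels α, w θ *
        ∑ i, (if θ ≤ (A i).elim 0 α then 1 else 0) * t i := by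
  obtain ⟨w, hw, hV⟩ := exists_layer_weights (levels α) fun _ => pos_of_mem_levels
  refine ⟨w, hw, fun t A => ?_⟩
  have hl : ∀ i, (A i).elim 0 (separable α t i) =
      ∑ θ ∈ levels α, w θ * ((if θ ≤ (A i).elim 0 α then 1 else 0) * t i) := by
    intro i
    have h1 : (A i).elim 0 (separable α t i) = (A i).elim 0 α * t i := by
      cases A i <;> simp [separable]
    have h2 : (A i).elim 0 α =
        ∑ θ ∈ levels α, w θ * if θ ≤ (A i).elim 0 α then 1 else 0 := by
      have hnn : 0 ≤ (A i).elim 0 α := by cases A i <;> simp [hα]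
      rcases hnn.eq_or_lt with h | h
      · rw [← h, Finset.sum_eq_zero]
        intro θ hθ
        rw [if_neg (pos_of_mem_levels hθ).not_ge, mul_zero]
      · refine hV _ (Finset.mem_filter.2 ⟨?_, h⟩)
        cases hA : A i with
        | none => simp [hA] at h
        | some j => simp
    rw [h1]
    conv_lhs => rw [h2]
    rw [Finset.sum_mul]
    exact Finset.sum_congr rfl fun θ _ => by ring
  rw [welfare, Finset.sum_congr rfl fun i _ => hl i, Finset.sum_comm]
  simp only [Finset.mul_sum]

/-- In a matching, the buyers who obtain a multiplier of at least `θ` are at most as many as the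
items of this kind, so that the sum of their types is bounded. -/
lemma IsMatching.sum_le {B : Allocation n m} (hB : IsMatching B) (t : Fin n → ℝ) {θ q : ℝ}
    (hθ : 0 < θ) (hq : 0 ≤ q) :
    ∑ i, (if θ ≤ (B i).elim 0 α then 1 else 0) * t i ≤
      (min (countGE α Finset.univ θ) n : ℕ) * q + ∑ i, max (t i - q) 0 := by
  set I := Finset.univ.filter fun i => θ ≤ (B i).elim 0 α with hI
  have hcard : I.card ≤ min (countGE α Finset.univ θ) n := by
    refine le_min ?_ ((Finset.card_le_univ _).trans_eq (Fintype.card_fin n))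
    rw [countGE, ← Finset.card_map (Function.Embedding.some : Fin m ↪ Option (Fin m))]
    refine Finset.card_le_card_of_injOn B (fun i hi => ?_) fun i hi i' hi' h => ?_
    · have hi : θ ≤ (B i).elim 0 α := (Finset.mem_filter.1 hi).2
      cases hBi : B i with
      | none => rw [hBi] at hi; exact absurd hi hθ.not_ge
      | some j => rw [hBi] at hi; simpa using hi
    · have hi : θ ≤ (B i).elim 0 α := (Finset.mem_filter.1 hi).2
      cases hBi : B i with
      | none => rw [hBi] at hi; exact absurd hi hθ.not_ge
      | some j => exact hB i i' j hBi (h ▸ hBi)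
  calc ∑ i, (if θ ≤ (B i).elim 0 α then 1 else 0) * t i = ∑ i ∈ I, t i := by
        rw [hI, Finset.sum_filter]
        exact Finset.sum_congr rfl fun i _ => by split_ifs <;> simp
    _ ≤ ∑ i ∈ I, (q + max (t i - q) 0) := Finset.sum_le_sum fun i _ => by
        linarith [le_max_left (t i - q) 0]
    _ = I.card * q + ∑ i ∈ I, max (t i - q) 0 := by
        rw [Finset.sum_add_distrib, Finset.sum_const, nsmul_eq_mul]
    _ ≤ _ := by
        gcongr
        exact Finset.subset_univ _

end Levels

/-! ### Outcomes of the mechanism -/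

section Outcome

variable {n m : ℕ} {α : Fin m → ℝ}

lemma remaining_zero (A : Allocation n m) (h : 0 < n) : remaining A ⟨0, h⟩ = Finset.univ := by
  ext j
  simp [remaining, Fin.lt_def]

lemma remaining_succ (A : Allocation n m) {i : ℕ} (h : i + 1 < n) :
    remaining A ⟨i + 1, h⟩ =
      (remaining A ⟨i, by omega⟩).filter fun j => A ⟨i, by omega⟩ ≠ some j := by
  ext j
  simp only [remaining, Finset.mem_filter, Finset.mem_univ, true_and, Fin.lt_def]
  constructor
  · exact fun hj => ⟨fun i' hi' => hj i' (by omega), hj _ (by simp)⟩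
  · rintro ⟨h1, h2⟩ i' hi'
    rcases Nat.lt_succ_iff_lt_or_eq.1 hi' with hlt | heq
    · exact h1 i' hlt
    · rwa [show i' = ⟨i, by omega⟩ from Fin.ext heq]

lemma countGE_filter_ne (M : Finset (Fin m)) {θ : ℝ} (hθ : 0 < θ) (o : Option (Fin m))
    (ho : ∀ j, o = some j → j ∈ M) :
    countGE α (M.filter fun j => o ≠ some j) θ =
      countGE α M θ - if θ ≤ o.elim 0 α then 1 else 0 := by
  cases o with
  | none => simp [hθ.not_ge]
  | some j =>
    have hj := ho j rfl
    have : (M.filter fun j' => some j ≠ some j') = M.erase j := by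
      ext j'; simp [and_comm, eq_comm]
    rw [this, Option.elim_some, countGE, countGE, Finset.filter_erase]
    split_ifs with h
    · rw [Finset.card_erase_of_mem (by simp [hj, h])]
    · rw [Finset.erase_eq_of_notMem (by simp [h])]; rfl

lemma sale_min (D : Measure ℝ) {N : ℕ} (hN : 0 < N) (K : ℕ) (t : ℝ) :
    sale D N (min K N) t = sale D N K t := by
  unfold sale
  have := demand_le_self (D := D) hN t
  congr 1
  simp [this]

variable {D : Measure ℝ} [IsProbabilityMeasure D] (hD : HasMonotoneHazardRate D)
  (h0 : D (Set.Iio 0) = 0) (hα : ∀ j, 0 ≤ α j)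

include hD h0 hα

/-- Whether buyer `i` obtains a multiplier of at least `θ` depends only on the number of remaining
items of this kind, whose evolution is described by `unsold`. -/
lemma IsOutcome.ite_eq_sale {t : Fin n → ℝ} {A : Allocation n m}
    (hA : IsOutcome (quantilePrices n D α) (separable α t) A)
    (ht : ∀ i : Fin n, IsGeneric D (n - i) (t i)) {θ : ℝ} (hθ : 0 < θ) (i : Fin n) :
    (if θ ≤ (A i).elim 0 α then 1 else 0) =
      sale D (n - i) (unsold D (min (countGE α Finset.univ θ) n) t i) (t i) := by
  have hsale : ∀ i : Fin n, (if θ ≤ (A i).elim 0 α then 1 else 0) =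
      sale D (n - i) (countGE α (remaining A i) θ) (t i) := fun i => by
    simp only [hA.elim_eq_kthMultiplier hD h0 hα i (ht i),
      le_kthMultiplier_iff hθ (demand_mem (D := D) (n - i) (t i)).1, sale]
  have hcount : ∀ (i : ℕ) (hi : i < n), min (countGE α (remaining A ⟨i, hi⟩) θ) (n - i) =
      unsold D (min (countGE α Finset.univ θ) n) t i := by
    intro i
    induction i with
    | zero => intro hi; simp [unsold, remaining_zero]
    | succ i ih =>
      intro hi
      have ih := ih (by omega)
      rw [unsold, dif_pos (by omega : i < n), ← ih, sale_min D (by omega), remaining_succ,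
        countGE_filter_ne _ hθ _ fun j hj => ((hA _).1 j hj).1, hsale]
      dsimp only
      set K := countGE α (remaining A ⟨i, by omega⟩) θ
      rcases lt_or_ge K (n - i) with h | h
      · omega
      · rw [sale, if_pos ((demand_le_self (by omega) _).trans h)]
        omega
  rw [hsale, ← hcount i i.2, sale_min D (by omega)]

end Outcome

lemma ae_isGeneric {D : Measure ℝ} (hD : HasMonotoneHazardRate D) (h0 : D (Set.Iio 0) = 0)
    (N : ℕ) : ∀ᵐ t ∂D, IsGeneric D N t := by
  have := hD.nullSingletonClass
  have h : ∀ᵐ t ∂D, ∀ k : ℕ, t ≠ threshold D (k / N) := ae_all_iff.2 fun k =>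
    compl_mem_ae_iff.2 (measure_singleton _)
  filter_upwards [ae_pos hD h0, h] with t h1 h2 using ⟨h1, fun k _ _ => h2 k⟩

section Competitive

variable {D : Measure ℝ} [IsProbabilityMeasure D] (hD : HasMonotoneHazardRate D)
  (h0 : D (Set.Iio 0) = 0) {Ω : Type*} [MeasurableSpace Ω] {P : Measure Ω}
  {n m : ℕ} {t : Fin n → Ω → ℝ} (ht : ∀ i, Measurable (t i))
  (hlaw : ∀ i, P.map (t i) = D) {α : Fin m → ℝ} (hα : ∀ j, 0 ≤ α j)

include hD h0 ht hlaw

omit [IsProbabilityMeasure D] in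
lemma ae_forall_isGeneric : ∀ᵐ ω ∂P, ∀ i : Fin n, IsGeneric D (n - i) (t i ω) :=
  ae_all_iff.2 fun i => ae_of_ae_map (ht i).aemeasurable (by
    rw [hlaw i]; exact ae_isGeneric hD h0 _)

include hα

lemma competitive_ratio [IsProbabilityMeasure P] (hind : iIndepFun t P) (hn : 2 ≤ n)
    {A : Ω → Allocation n m} (hA : ∀ᵐ ω ∂P,
      IsOutcome (quantilePrices n D α) (separable α fun i => t i ω) (A ω)) :
    Integrable (fun ω => welfare (separable α fun i => t i ω) (A ω)) P ∧
      Integrable (fun ω => optWelfare (separable α fun i => t i ω)) P ∧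
      (1 - 8 / Real.log n) * ∫ ω, optWelfare (separable α fun i => t i ω) ∂P ≤
        ∫ ω, welfare (separable α fun i => t i ω) (A ω) ∂P := by
  obtain ⟨w, hw, hwel⟩ := exists_welfare_eq (n := n) hα
  set k : ℝ → ℕ := fun θ => min (countGE α Finset.univ θ) n with hk
  have hkn : ∀ θ, k θ ≤ n := fun θ => min_le_right _ _
  have hk0 : ∀ θ ∈ levels α, 0 < k θ := fun θ hθ =>
    lt_min (countGE_pos_of_mem_levels hθ) (by omega)
  have hn0 : (0 : ℝ) < n := by positivity
  -- the welfare of the mechanism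
  have hae : (fun ω => welfare (separable α fun i => t i ω) (A ω)) =ᵐ[P] fun ω =>
      ∑ θ ∈ levels α, w θ *
        ∑ i : Fin n, sale D (n - i) (unsold D (k θ) (fun j => t j ω) i) (t i ω) * t i ω := by
    filter_upwards [hA, ae_forall_isGeneric hD h0 ht hlaw] with ω h1 h2
    rw [hwel]
    refine Finset.sum_congr rfl fun θ hθ => ?_
    congr 1
    refine Finset.sum_congr rfl fun i _ => ?_
    rw [← h1.ite_eq_sale hD h0 hα h2 (pos_of_mem_levels hθ) i]
    push_cast; rfl
  have hsi : ∀ θ (i : Fin n), Integrable (fun ω =>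
      sale D (n - i) (unsold D (k θ) (fun j => t j ω) i) (t i ω) * t i ω) P := fun θ i =>
    (integral_sale_mul_type hD h0 ht hind hlaw (hkn θ) i).1
  have hLi : ∀ θ, Integrable (fun ω => w θ *
      ∑ i : Fin n, sale D (n - i) (unsold D (k θ) (fun j => t j ω) i) (t i ω) * t i ω) P :=
    fun θ => (integrable_finsetSum _ fun i _ => hsi θ i).const_mul _
  have hLint : Integrable (fun ω => welfare (separable α fun i => t i ω) (A ω)) P :=
    (integrable_congr hae).2 (integrable_finsetSum _ fun θ _ => hLi θ)
  -- the upper bound on the optimal welfare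
  set U : ℝ → Ω → ℝ := fun θ ω =>
    k θ * threshold D (k θ / n) + ∑ i, max (t i ω - threshold D (k θ / n)) 0 with hU
  have hUi : ∀ θ ∈ levels α, Integrable (fun ω => w θ * U θ ω) P := fun θ hθ =>
    (integral_add_sum_max hD h0 ht hlaw (hk0 θ hθ) (hkn θ)).1.const_mul _
  have hle : ∀ ω, optWelfare (separable α fun i => t i ω) ≤ ∑ θ ∈ levels α, w θ * U θ ω := by
    intro ω
    have : Nonempty {A : Allocation n m // IsMatching A} :=
      ⟨⟨fun _ => none, fun _ _ _ h => by simp at h⟩⟩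
    refine ciSup_le fun B => ?_
    rw [hwel]
    refine Finset.sum_le_sum fun θ hθ => mul_le_mul_of_nonneg_left ?_ (hw θ)
    refine B.2.sum_le _ (pos_of_mem_levels hθ) (threshold_nonneg hD h0 ?_)
    have := hk0 θ hθ
    positivity
  have hnn : ∀ ω, 0 ≤ optWelfare (separable α fun i => t i ω) := by
    intro ω
    refine le_trans ?_ (le_ciSup (Set.finite_range _).bddAbove
      (⟨fun _ => none, fun _ _ _ h => by simp at h⟩ : {A : Allocation n m // IsMatching A}))
    simp [welfare]
  have hUint := integrable_finsetSum _ hUi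
  have hmeas : Measurable fun ω => optWelfare (separable α fun i => t i ω) := by
    refine Measurable.iSup fun B => Finset.measurable_sum _ fun i _ => ?_
    cases B.1 i with
    | none => exact measurable_const
    | some j => exact (ht i).const_mul _
  have hOint : Integrable (fun ω => optWelfare (separable α fun i => t i ω)) P := by
    refine hUint.mono' hmeas.aestronglyMeasurable (Filter.Eventually.of_forall fun ω => ?_)
    rw [Real.norm_of_nonneg (hnn ω)]
    exact hle ω
  refine ⟨hLint, hOint, ?_⟩
  have hL : ∫ ω, welfare (separable α fun i => t i ω) (A ω) ∂P = ∑ θ ∈ levels α, w θ *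
      ∑ i : Fin n, ∫ ω, sale D (n - i) (unsold D (k θ) (fun j => t j ω) i) (t i ω) * t i ω ∂P := by
    rw [integral_congr_ae hae, integral_finsetSum _ fun θ _ => hLi θ]
    refine Finset.sum_congr rfl fun θ _ => ?_
    rw [integral_const_mul, integral_finsetSum _ fun i _ => hsi θ i]
  have hLge : (1 - 8 / Real.log n) * ∑ θ ∈ levels α, w θ * (n * gain D (k θ / n)) ≤
      ∫ ω, welfare (separable α fun i => t i ω) (A ω) ∂P := by
    rw [hL, Finset.mul_sum]
    refine Finset.sum_le_sum fun θ hθ => ?_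
    rw [mul_left_comm]
    exact mul_le_mul_of_nonneg_left
      (sum_integral_sale_mul_type_ge hD h0 ht hind hlaw hn (hk0 θ hθ) (hkn θ)) (hw θ)
  have hO : ∫ ω, optWelfare (separable α fun i => t i ω) ∂P ≤
      ∑ θ ∈ levels α, w θ * (n * gain D (k θ / n)) := by
    refine (integral_mono hOint hUint hle).trans_eq ?_
    rw [integral_finsetSum _ hUi]
    refine Finset.sum_congr rfl fun θ hθ => ?_
    rw [integral_const_mul, (integral_add_sum_max hD h0 ht hlaw (hk0 θ hθ) (hkn θ)).2]
  rcases le_total 0 (1 - 8 / Real.log n) with h | h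
  · exact (mul_le_mul_of_nonneg_left hO h).trans hLge
  -- a negative factor makes the claim trivial, as both welfares are nonnegative
  · refine (mul_nonpos_of_nonpos_of_nonneg h (integral_nonneg hnn)).trans ?_
    refine integral_nonneg_of_ae ?_
    filter_upwards [hae, ae_forall_isGeneric hD h0 ht hlaw] with ω h1 h2
    rw [h1]
    exact Finset.sum_nonneg fun θ _ => mul_nonneg (hw θ) (Finset.sum_nonneg fun i _ =>
      mul_nonneg (Nat.cast_nonneg _) (h2 i).1.le)

end Competitive

/-! ### Selling one item to every buyer -/

/-- The item of `M` in position `r`, if there is one. -/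
noncomputable def itemAt {m : ℕ} (α : Fin m → ℝ) (M : Finset (Fin m)) (r : ℕ) : Option (Fin m) :=
  open Classical in if h : ∃ j ∈ M, position α M j = r then some h.choose else none

/-- The items that remain when buyer `i` arrives, if every buyer buys the item in the demanded
position; after `i = n` the value is irrelevant. -/
noncomputable def stock (D : Measure ℝ) {n m : ℕ} (α : Fin m → ℝ) (t : Fin n → ℝ) :
    ℕ → Finset (Fin m)
  | 0 => Finset.univ
  | i + 1 => if h : i < n then (stock D α t i).filter fun j =>
      itemAt α (stock D α t i) (demand D (n - i) (t ⟨i, h⟩)) ≠ some j else ∅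

/-- The allocation in which every buyer buys the item in the demanded position. -/
noncomputable def demandAllocation (D : Measure ℝ) {n m : ℕ} (α : Fin m → ℝ) (t : Fin n → ℝ) :
    Allocation n m :=
  fun i => itemAt α (stock D α t i) (demand D (n - i) (t i))

section Demand

variable {D : Measure ℝ} {n m : ℕ} {α : Fin m → ℝ}

lemma itemAt_eq_some_iff {M : Finset (Fin m)} {r : ℕ} {j : Fin m} :
    itemAt α M r = some j ↔ j ∈ M ∧ position α M j = r := by
  unfold itemAt
  split_ifs with h
  · obtain ⟨h1, h2⟩ := h.choose_spec
    rw [Option.some_inj]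
    constructor
    · rintro rfl; exact ⟨h1, h2⟩
    · rintro ⟨h3, h4⟩; exact position_injOn h1 h3 (h2.trans h4.symm)
  · simp only [false_iff]
    exact fun h' => h ⟨j, h'⟩

lemma remaining_demandAllocation (t : Fin n → ℝ) (i : ℕ) (hi : i < n) :
    remaining (demandAllocation D α t) ⟨i, hi⟩ = stock D α t i := by
  induction i with
  | zero => exact remaining_zero _ _
  | succ i ih =>
    rw [remaining_succ, ih (by omega), stock, dif_pos (by omega)]
    rfl

lemma exists_itemAt_eq {M : Finset (Fin m)} {N : ℕ} (hM : M.card = N) (hN : 0 < N) (t : ℝ) :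
    ∃ j, itemAt α M (demand D N t) = some j := by
  obtain ⟨j, hj, hjr⟩ := exists_position_eq (α := α) (M := M) (demand_mem (D := D) N t).1
    ((demand_le_self hN t).trans_eq hM.symm)
  exact ⟨j, itemAt_eq_some_iff.2 ⟨hj, hjr⟩⟩

lemma card_stock (hmn : m = n) (t : Fin n → ℝ) (i : ℕ) (hi : i ≤ n) :
    (stock D α t i).card = n - i := by
  induction i with
  | zero => simp [stock, hmn]
  | succ i ih =>
    have ih := ih (by omega)
    obtain ⟨j, hj⟩ := exists_itemAt_eq (D := D) (α := α) ih (by omega) (t ⟨i, hi⟩)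
    rw [stock, dif_pos (by omega), hj]
    have : ((stock D α t i).filter fun j' => some j ≠ some j') = (stock D α t i).erase j := by
      ext j'; simp [and_comm, eq_comm]
    rw [this, Finset.card_erase_of_mem (itemAt_eq_some_iff.1 hj).1, ih]
    omega

lemma stock_congr {t t' : Fin n → ℝ} {i : ℕ} (h : ∀ j : Fin n, (j : ℕ) < i → t j = t' j) :
    stock D α t i = stock D α t' i := by
  induction i with
  | zero => rfl
  | succ i ih =>
    rw [stock, stock, ih fun j hj => h j (by omega)]
    split_ifs with hi
    · rw [h ⟨i, hi⟩ (Nat.lt_succ_self i)]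
    · rfl

lemma measurableSet_stock_eq (i : ℕ) (M : Finset (Fin m)) :
    MeasurableSet {t : Fin n → ℝ | stock D α t i = M} := by
  induction i generalizing M with
  | zero => simp [stock]
  | succ i ih =>
    by_cases hi : i < n
    · have : {t : Fin n → ℝ | stock D α t (i + 1) = M} = ⋃ M', {t | stock D α t i = M'} ∩
          (fun t : Fin n → ℝ => demand D (n - i) (t ⟨i, hi⟩)) ⁻¹'
            {r | (M'.filter fun j => itemAt α M' r ≠ some j) = M} := by
        ext t
        simp [stock, hi]
      rw [this]
      exact MeasurableSet.iUnion fun M' => (ih M').inter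
        (((measurable_demand _).comp (measurable_pi_apply _)) (Set.to_countable _).measurableSet)
    · simp [stock, hi]

lemma measurableSet_demandAllocation_eq (a : Allocation n m) :
    MeasurableSet {t : Fin n → ℝ | demandAllocation D α t = a} := by
  have : {t : Fin n → ℝ | demandAllocation D α t = a} = ⋂ i : Fin n, ⋃ M,
      {t | stock D α t i = M} ∩ (fun t : Fin n → ℝ => demand D (n - i) (t i)) ⁻¹'
        {r | itemAt α M r = a i} := by
    ext t
    simp [demandAllocation, funext_iff]
  rw [this]
  exact MeasurableSet.iInter fun i => MeasurableSet.iUnion fun M =>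
    (measurableSet_stock_eq _ M).inter
      (((measurable_demand _).comp (measurable_pi_apply _)) (Set.to_countable _).measurableSet)

variable [IsProbabilityMeasure D] (hD : HasMonotoneHazardRate D) (h0 : D (Set.Iio 0) = 0)

include hD h0

lemma measureReal_demand_eq {N r : ℕ} (hr : 1 ≤ r) (hrN : r ≤ N) :
    D.real (demand D N ⁻¹' {r}) = 1 / N := by
  obtain ⟨s, rfl⟩ : ∃ s, r = s + 1 := ⟨r - 1, by omega⟩
  have : demand D N ⁻¹' {s + 1} = {t | demand D N t ≤ s + 1} \ {t | demand D N t ≤ s} := by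
    ext t; simp; omega
  have hsub : {t | demand D N t ≤ s} ⊆ {t | demand D N t ≤ s + 1} :=
    fun t (ht : demand D N t ≤ s) => Nat.le_succ_of_le ht
  rw [this, measureReal_sdiff hsub (measurable_demand N measurableSet_Iic), measureReal_demand_le hD h0 (by omega) hrN,
    measureReal_demand_le hD h0 (by omega) (by omega), ← sub_div]
  push_cast; ring

variable {Ω : Type*} [MeasurableSpace Ω] {P : Measure Ω} {t : Fin n → Ω → ℝ}
  (ht : ∀ i, Measurable (t i)) (hind : iIndepFun t P) (hlaw : ∀ i, P.map (t i) = D)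

include ht hind hlaw

/-- Each remaining item is sold with the same probability, because the demanded position is
uniformly distributed and independent of the set of remaining items. -/
lemma measureReal_demandAllocation_eq (hmn : m = n) (i : Fin n) {M : Finset (Fin m)} {j : Fin m}
    (hj : j ∈ M) :
    P.real {ω | remaining (demandAllocation D α fun i => t i ω) i = M ∧
        demandAllocation D α (fun i => t i ω) i = some j} =
      P.real {ω | remaining (demandAllocation D α fun i => t i ω) i = M} /
        ((n : ℝ) - (i : ℕ)) := by
  have hrem : ∀ ω, remaining (demandAllocation D α fun i => t i ω) i =
      stock D α (fun i => t i ω) i := fun ω => remaining_demandAllocation _ i i.2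
  simp only [hrem]
  by_cases hM : M.card = n - i
  · have hset : {ω | stock D α (fun i => t i ω) i = M ∧
        demandAllocation D α (fun i => t i ω) i = some j} =
        (fun ω => stock D α (fun i => t i ω) i = M) ⁻¹' {True} ∩
          t i ⁻¹' (demand D (n - i) ⁻¹' {position α M j}) := by
      ext ω
      simp only [Set.mem_ofPred_eq, Set.mem_inter_iff, Set.mem_preimage, Set.mem_singleton_iff,
        eq_iff_iff, iff_true, demandAllocation]
      refine and_congr_right fun h => ?_
      rw [h, itemAt_eq_some_iff]
      exact ⟨fun h => h.2.symm, fun h => ⟨hj, h.symm⟩⟩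
    have hZ : Measurable fun u : Fin n → ℝ => (stock D α u i = M) :=
      measurableSet_setOfPred.1 (measurableSet_stock_eq _ _)
    have hI := hind.indepFun_of_forall_lt ht i hZ fun u u' h => by
      rw [stock_congr fun j hj => h j hj]
    have hB : MeasurableSet (demand D (n - i) ⁻¹' {position α M j}) :=
      measurable_demand _ (measurableSet_singleton _)
    rw [hset, measureReal_def, hI.measure_inter_preimage_eq_mul _ _ (measurableSet_singleton _) hB,
      ENNReal.toReal_mul, ← Measure.map_apply (ht i) hB, hlaw i, ← measureReal_def,
      ← measureReal_def, measureReal_demand_eq hD h0 (one_le_position hj)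
        ((position_le_card j).trans_eq hM), Nat.cast_sub i.2.le, mul_one_div]
    congr 2
    ext ω; simp
  · have hne : ∀ ω, stock D α (fun i => t i ω) i ≠ M := fun ω h =>
      hM (h ▸ card_stock hmn _ i i.2.le)
    simp [hne]

end Demand

/-! ### The competitive ratio and the equal selling probabilities -/

theorem mainTheorem3 :
    ∃ C : ℝ, 0 < C ∧
      ∀ (n m : ℕ), 2 ≤ n →
      ∀ (α : Fin m → ℝ), (∀ j, 0 ≤ α j) →
      ∀ (D : Measure ℝ), IsProbabilityMeasure D → D (Set.Iio 0) = 0 →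
        HasMonotoneHazardRate D →
      ∀ (Ω : Type*) [MeasurableSpace Ω] (P : Measure Ω), IsProbabilityMeasure P →
      ∀ (t : Fin n → Ω → ℝ), (∀ i, Measurable (t i)) → iIndepFun t P →
        (∀ i, P.map (t i) = D) →
      -- the competitive ratio, however the buyers break ties
      (∀ A : Ω → Allocation n m,
        (∀ᵐ ω ∂P, IsOutcome (quantilePrices n D α) (separable α fun i => t i ω) (A ω)) →
          Integrable (fun ω => welfare (separable α fun i => t i ω) (A ω)) P ∧
          Integrable (fun ω => optWelfare (separable α fun i => t i ω)) P ∧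
          (1 - C / Real.log n) * ∫ ω, optWelfare (separable α fun i => t i ω) ∂P ≤
            ∫ ω, welfare (separable α fun i => t i ω) (A ω) ∂P) ∧
      -- with as many items as buyers and suitable tie-breaking, each step sells one item, and each
      -- remaining item with the same probability
      (m = n → ∃ A : Ω → Allocation n m,
        (∀ a, MeasurableSet {ω | A ω = a}) ∧
        (∀ᵐ ω ∂P, IsOutcome (quantilePrices n D α) (separable α fun i => t i ω) (A ω)) ∧
        (∀ᵐ ω ∂P, ∀ i, A ω i ≠ none) ∧
        ∀ (i : Fin n) (M : Finset (Fin m)), ∀ j ∈ M,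
          P.real {ω | remaining (A ω) i = M ∧ A ω i = some j} =
            P.real {ω | remaining (A ω) i = M} / ((n : ℝ) - (i : ℕ))) := by
  refine ⟨8, by norm_num, ?_⟩
  intro n m hn α hα D hDp h0 hD Ω _ P hP t ht hind hlaw
  refine ⟨fun A hA => competitive_ratio hD h0 ht hlaw hα hind hn hA, fun hmn =>
    ⟨fun ω => demandAllocation D α fun i => t i ω, fun a => ?_, ?_, ?_, fun i M j hj =>
      measureReal_demandAllocation_eq hD h0 ht hind hlaw hmn i hj⟩⟩
  · exact measurable_pi_lambda _ ht (measurableSet_demandAllocation_eq a)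
  · filter_upwards [ae_forall_isGeneric hD h0 ht hlaw] with ω hω
    refine isOutcome_of_position_eq_demand hD h0 hα hω fun i => ?_
    obtain ⟨j, hj⟩ := exists_itemAt_eq (D := D) (α := α)
      (card_stock (D := D) (α := α) hmn (fun i => t i ω) i i.2.le) (by omega) (t i ω)
    rw [remaining_demandAllocation _ _ i.2]
    exact ⟨j, (itemAt_eq_some_iff.1 hj).1, hj, (itemAt_eq_some_iff.1 hj).2⟩
  · refine Filter.Eventually.of_forall fun ω i => ?_
    obtain ⟨j, hj⟩ := exists_itemAt_eq (D := D) (α := α)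
      (card_stock (D := D) (α := α) hmn (fun i => t i ω) i i.2.le) (by omega) (t i ω)
    exact fun h => by simp [demandAllocation, hj] at h
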